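/- **Proposition (intractability of minimal-time reachability synthesis for L/U-PTAs).** A *parametric timed automaton* (PTA) has finitely many actions, locations (one of them initial), clocks $x$ and parameters $p$, a guard as invariant of every location, and finitely many edges, each labelled with a guard, an action and a set of clocks to reset; a guard is a conjunction of inequalities $x \bowtie d$ or $x \bowtie p$ with $d\in\mathbb N$ and ${\bowtie}\in\{<,\le,=,\ge,>\}$. It is an *L/U-PTA* if its parameters can be partitioned into lower-bound parameters, which occur only as $p\le x$ or $p<x$, and upper-bound parameters, which occur only as $p\ge x$ or $p>x$. A parameter valuation $v$ assigns a value in $\mathbb Q_{\ge 0}$ to each of the $n$ parameters and turns a PTA $\mathcal A$ into a timed automaton $v(\mathcal A)$. A run starts in the initial location with all clocks at $0$; each step is a delay followed by an edge, and all states visited satisfy the invariants; its duration is the sum of its delays. For a set $T$ of locations, $\mathrm{MinTimeReach}(v(\mathcal A),T)$ is the infimum $c$ of the durations of the finite runs of $v(\mathcal A)$ that reach $T$, tagged as $(c,=)$ if it is attained and as $(c,>)$ if not, and is $\infty$ if there is no such run. These values are ordered by $c$ first, then ${=}$ before ${>}$, with $\infty$ as largest element; $\mathrm{MinTimePTA}(\mathcal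 A,T)$ is their greatest lower bound over all $v$, and $$\mathrm{MinTimeSynth}(\mathcal A,T)=\{v \mid \mathrm{MinTimeReach}(v(\mathcal A),T)=\mathrm{MinTimePTA}(\mathcal A,T)\}.$$ A *formalism* consists, for every $n$, of finite descriptions (encoded as natural numbers) of subsets of $\mathbb Q_{\ge0}^n$. It *has decidable emptiness of the intersection* if, for every $n$, one can decide from two descriptions whether the two sets they denote are disjoint. A *polyhedron* is the set of valuations that satisfy a finite conjunction of inequalities $\sum_j\beta_jp_j+d\bowtie0$ with $\beta_j,d\in\mathbb Z$. 1. No formalism with decidable emptiness of the intersection admits a solution of minimal-time reachability synthesis for L/U-PTAs, that is, algorithms (one for each number of clocks and each number of parameters) that, given an L/U-PTA $\mathcal A$ and a set $T$ of its locations, return a description of $\mathrm{MinTimeSynth}(\mathcal A,T)$. 2. There are an L/U-PTA $\mathcal A$ and a set $T$ of its locations such that $\mathrm{MinTimeSynth}(\mathcal A,T)$ has no description at all in any formalism that has decidable emptiness of the intersection and into which polyhedra can be translated effectively; in particular, $\mathrm{MinTimeSynth}(\mathcal A,T)$ is not a finite union of polyhedra. -/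

import Mathlib

open scoped NNReal NNRat

/-- The comparison operators `<, ≤, =, ≥, >`. -/
inductive Cmp where
  | lt | le | eq | ge | gt

namespace Cmp

def equivFin : Cmp ≃ Fin 5 where
  toFun
    | lt => 0
    | le => 1
    | eq => 2
    | ge => 3
    | gt => 4
  invFun
    | 0 => lt
    | 1 => le
    | 2 => eq
    | 3 => ge
    | 4 => gt
  left_inv c := by cases c <;> rfl
  right_inv i := by fin_cases i <;> rfl

instance : Primcodable Cmp := Primcodable.ofEquiv (Fin 5) equivFin

def Holds {α : Type} [LT α] [LE α] : Cmp → α → α → Prop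
  | lt, x, y => x < y
  | le, x, y => x ≤ y
  | eq, x, y => x = y
  | ge, x, y => x ≥ y
  | gt, x, y => x > y

end Cmp

/-- A parameter valuation over `n` parameters. -/
abbrev ParamVal (n : ℕ) : Type := Fin n → ℚ≥0

/-- A clock valuation over `k` clocks. -/
abbrev ClockVal (k : ℕ) : Type := Fin k → ℝ≥0

/-- An inequality `x ⋈ d` with `d ∈ ℕ`, or `x ⋈ p`, with `x` one of `k` clocks and `p` one of
`n` parameters. -/
structure Atom (k n : ℕ) where
  clock : Fin k
  cmp : Cmp
  bound : ℕ ⊕ Fin n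

/-- A guard: a finite conjunction of inequalities. -/
abbrev Guard (k n : ℕ) : Type := List (Atom k n)

/-- An edge `(ℓ, g, a, R, ℓ')`. Locations and actions are numbers, and the list `reset` stands for
the set `R` of its members. -/
structure Edge (k n : ℕ) where
  src : ℕ
  guard : Guard k n
  act : ℕ
  reset : List (Fin k)
  tgt : ℕ

/-- The data of a parametric timed automaton with `k` clocks and `n` parameters. Its actions are
the numbers below `numAct`; its locations are the numbers below `inv.length`, and `inv` lists their
invariants. -/
structure PTA (k n : ℕ) where
  numAct : ℕ
  init : ℕ
  inv : List (Guard k n)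
  edges : List (Edge k n)

/-! Encodings of automata as finite words, through tuples and lists of their components. -/

def Atom.equivProd (k n : ℕ) : Atom k n ≃ Fin k × Cmp × (ℕ ⊕ Fin n) where
  toFun a := (a.clock, a.cmp, a.bound)
  invFun t := ⟨t.1, t.2.1, t.2.2⟩
  left_inv _ := rfl
  right_inv _ := rfl

instance (k n : ℕ) : Primcodable (Atom k n) := Primcodable.ofEquiv _ (Atom.equivProd k n)

def Edge.equivProd (k n : ℕ) : Edge k n ≃ ℕ × Guard k n × ℕ × List (Fin k) × ℕ where
  toFun e := (e.src, e.guard, e.act, e.reset, e.tgt)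
  invFun t := ⟨t.1, t.2.1, t.2.2.1, t.2.2.2.1, t.2.2.2.2⟩
  left_inv _ := rfl
  right_inv _ := rfl

instance (k n : ℕ) : Primcodable (Edge k n) := Primcodable.ofEquiv _ (Edge.equivProd k n)

def PTA.equivProd (k n : ℕ) :
    PTA k n ≃ ℕ × ℕ × List (Guard k n) × List (Edge k n) where
  toFun A := (A.numAct, A.init, A.inv, A.edges)
  invFun t := ⟨t.1, t.2.1, t.2.2.1, t.2.2.2⟩
  left_inv _ := rfl
  right_inv _ := rfl

instance (k n : ℕ) : Primcodable (PTA k n) := Primcodable.ofEquiv _ (PTA.equivProd k n)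

/-! Semantics of guards. -/

section Guards

variable {k n : ℕ}

/-- The value of the right-hand side of an inequality under a parameter valuation. -/
def Atom.boundVal (a : Atom k n) (v : ParamVal n) : ℝ≥0 :=
  Sum.elim (fun d : ℕ => (d : ℝ≥0)) (fun p : Fin n => ((v p : ℚ≥0) : ℝ≥0)) a.bound

def Atom.Sat (a : Atom k n) (v : ParamVal n) (w : ClockVal k) : Prop :=
  a.cmp.Holds (w a.clock) (a.boundVal v)

def Guard.Sat (g : Guard k n) (v : ParamVal n) (w : ClockVal k) : Prop :=
  ∀ a ∈ g, Atom.Sat a v w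

/-- Time elapsing by `d`. -/
def ClockVal.delay (w : ClockVal k) (d : ℝ≥0) : ClockVal k := fun x => w x + d

/-- Resetting the clocks in `R`. -/
def ClockVal.reset (w : ClockVal k) (R : List (Fin k)) : ClockVal k :=
  fun x => if x ∈ R then 0 else w x

end Guards

/-- The values that a minimal time may take: `(c, =)`, written `(c, false)`, `(c, >)`, written
`(c, true)`, and `∞`, written `⊤`, in the lexicographic order with `=` before `>`. -/
abbrev MinVal : Type := WithTop (ℝ≥0 ×ₗ Bool)

namespace MinVal

/-- The value `(c, =)`. -/
def exact (c : ℝ≥0) : MinVal := WithTop.some (toLex (c, false))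

/-- The value `(c, >)`. -/
def above (c : ℝ≥0) : MinVal := WithTop.some (toLex (c, true))

theorem exists_isGLB (S : Set MinVal) : ∃ m, IsGLB S m := by
  classical
  -- the infimum `c` of the first components of the finite members of `S`
  let D : Set ℝ≥0 := {c | ∃ b, (WithTop.some (toLex (c, b)) : MinVal) ∈ S}
  have le_iff : ∀ (c d : ℝ≥0) (a b : Bool),
      ((WithTop.some (toLex (c, a)) : MinVal) ≤ WithTop.some (toLex (d, b))) ↔
        c < d ∨ c = d ∧ a ≤ b := fun c d a b => by
    rw [WithTop.coe_le_coe, Prod.Lex.toLex_le_toLex]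
  have key : ∀ m : MinVal, m ∈ lowerBounds S ↔
      ∀ c b, (WithTop.some (toLex (c, b)) : MinVal) ∈ S → m ≤ WithTop.some (toLex (c, b)) := by
    refine fun m => ⟨fun h c b hc => h hc, fun h x hx => ?_⟩
    induction x using WithTop.recTopCoe with
    | top => exact le_top
    | coe x => exact h (ofLex x).1 (ofLex x).2 hx
  rcases D.eq_empty_or_nonempty with hD | hD
  · refine ⟨⊤, (key _).2 fun c b hc => ?_, fun _ _ => le_top⟩
    exact absurd (show c ∈ D from ⟨b, hc⟩) (by simp [hD])
  · have hc : IsGLB D (sInf D) := isGLB_csInf hD (OrderBot.bddBelow D)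
    have hlt : ∀ (m : MinVal), m ∈ lowerBounds S → ∃ d a, m = WithTop.some (toLex (d, a)) := by
      intro m hm
      obtain ⟨c, b, hcb⟩ := hD
      induction m using WithTop.recTopCoe with
      | top => exact absurd (hm hcb) (by simp)
      | coe x => exact ⟨(ofLex x).1, (ofLex x).2, rfl⟩
    by_cases hmem : (WithTop.some (toLex (sInf D, false)) : MinVal) ∈ S
    · refine ⟨_, (key _).2 fun c b hcb => (le_iff _ _ _ _).2 ?_, fun m hm => hm hmem⟩
      rcases (hc.1 ⟨b, hcb⟩ : sInf D ≤ c).lt_or_eq with h | h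
      · exact Or.inl h
      · exact Or.inr ⟨h, Bool.false_le b⟩
    · refine ⟨WithTop.some (toLex (sInf D, true)),
        (key _).2 fun c b hcb => (le_iff _ _ _ _).2 ?_, fun m hm => ?_⟩
      · rcases (hc.1 ⟨b, hcb⟩ : sInf D ≤ c).lt_or_eq with h | h
        · exact Or.inl h
        · refine Or.inr ⟨h, ?_⟩
          cases b with
          | true => exact le_rfl
          | false => exact absurd (h ▸ hcb) hmem
      · obtain ⟨d, a, rfl⟩ := hlt m hm
        have hd : d ≤ sInf D := hc.2 fun c ⟨b, hcb⟩ => by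
          rcases (le_iff _ _ _ _).1 (hm hcb) with h | h
          · exact h.le
          · exact h.1.le
        rw [le_iff]
        rcases hd.lt_or_eq with h | h
        · exact Or.inl h
        · exact Or.inr ⟨h, Bool.le_true a⟩

/-- The minimum of a set of values: its greatest lower bound. For a non-empty set of exact values
`(d, =)` it is the infimum `c` of the `d`, tagged with `=` if `c` is attained and with `>`
otherwise; for the empty set it is `∞`. -/
noncomputable def minimum (S : Set MinVal) : MinVal := (exists_isGLB S).choose

theorem isGLB_minimum (S : Set MinVal) : IsGLB S (minimum S) := (exists_isGLB S).choose_spec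

end MinVal

namespace PTA

variable {k n : ℕ}

/-- The number of locations. -/
def numLoc (A : PTA k n) : ℕ := A.inv.length

/-- The invariant of a location. -/
def invariant (A : PTA k n) (l : ℕ) : Guard k n := A.inv.getD l []

/-- The data describe a parametric timed automaton: the initial location and the ends of all edges
are locations, and the labels of all edges are actions. -/
structure WellFormed (A : PTA k n) : Prop where
  init_lt : A.init < A.numLoc
  edges_lt : ∀ e ∈ A.edges, e.src < A.numLoc ∧ e.act < A.numAct ∧ e.tgt < A.numLoc

/-- All guards and invariants of the automaton. -/
def guards (A : PTA k n) : List (Guard k n) := A.inv ++ A.edges.map Edge.guard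

/-- L/U-PTA: the parameters are partitioned into lower-bound parameters (those in `L`), which occur
only as `p ≤ x` or `p < x`, and upper-bound parameters (the others), which occur only as `p ≥ x` or
`p > x`. -/
def IsLU (A : PTA k n) : Prop :=
  ∃ L : Set (Fin n), ∀ g ∈ A.guards, ∀ a ∈ g, ∀ p : Fin n, a.bound = Sum.inr p →
    (p ∈ L ∧ (a.cmp = Cmp.ge ∨ a.cmp = Cmp.gt)) ∨ (p ∉ L ∧ (a.cmp = Cmp.le ∨ a.cmp = Cmp.lt))

/-- The concrete states of the timed automaton `v(A)`. -/
def IsState (A : PTA k n) (v : ParamVal n) (l : ℕ) (w : ClockVal k) : Prop :=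
  l < A.numLoc ∧ (A.invariant l).Sat v w

/-- The delay transition `(l, w) → (l, w + d)`. -/
def DelayStep (A : PTA k n) (v : ParamVal n) (l : ℕ) (w : ClockVal k) (d : ℝ≥0) : Prop :=
  ∀ d' ≤ d, A.IsState v l (w.delay d')

/-- The discrete transition `(l, w) → (l', w')` along an edge. -/
def EdgeStep (A : PTA k n) (v : ParamVal n) (e : Edge k n) (l : ℕ) (w : ClockVal k)
    (l' : ℕ) (w' : ClockVal k) : Prop :=
  e ∈ A.edges ∧ e.src = l ∧ e.tgt = l' ∧ A.IsState v l w ∧ A.IsState v l' w' ∧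
    e.guard.Sat v w ∧ w' = w.reset e.reset

/-- `A.Run v l w t`: there is a finite run of `v(A)` that ends in the state `(l, w)` and has
duration `t`. A run starts in the initial location with all clocks at `0`, and each of its steps is
a delay followed by a discrete transition. -/
inductive Run (A : PTA k n) (v : ParamVal n) : ℕ → ClockVal k → ℝ≥0 → Prop
  | init : A.IsState v A.init (fun _ => 0) → Run A v A.init (fun _ => 0) 0
  | step {l l' : ℕ} {w w' : ClockVal k} {t d : ℝ≥0} {e : Edge k n} :
      Run A v l w t → A.DelayStep v l w d → A.EdgeStep v e l (w.delay d) l' w' →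
      Run A v l' w' (t + d)

/-- The durations of the finite runs of `v(A)` that reach a location of `T`. -/
def reachDurations (A : PTA k n) (v : ParamVal n) (T : List ℕ) : Set ℝ≥0 :=
  {t | ∃ l ∈ T, ∃ w, A.Run v l w t}

/-- The minimal time in which `v(A)` reaches `T`. -/
noncomputable def minTimeReach (A : PTA k n) (v : ParamVal n) (T : List ℕ) : MinVal :=
  MinVal.minimum (MinVal.exact '' A.reachDurations v T)

/-- The minimal time in which `T` is reached, over all parameter valuations. -/
noncomputable def minTimePTA (A : PTA k n) (T : List ℕ) : MinVal :=
  MinVal.minimum (Set.range fun v : ParamVal n => A.minTimeReach v T)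

/-- The valuations for which `T` is reached in minimal time. -/
def minTimeSynth (A : PTA k n) (T : List ℕ) : Set (ParamVal n) :=
  {v | A.minTimeReach v T = A.minTimePTA T}

/-- An instance of minimal-time reachability synthesis for L/U-PTAs: an L/U-PTA and a set `T`
(given as a list) of its locations. -/
structure IsLUInstance (A : PTA k n) (T : List ℕ) : Prop where
  wellFormed : A.WellFormed
  isLU : A.IsLU
  target_lt : ∀ l ∈ T, l < A.numLoc

end PTA

/-- A linear inequality `∑ j, coeff j * p j + const ⋈ 0` with integer coefficients over `n`
parameters. -/
abbrev LinIneq (n : ℕ) : Type := (Fin n → ℤ) × ℤ × Cmp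

/-- A convex polyhedron: a finite conjunction of linear inequalities. -/
abbrev Polyhedron (n : ℕ) : Type := List (LinIneq n)

/-- The parameter valuations in a polyhedron. -/
def Polyhedron.toSet {n : ℕ} (P : Polyhedron n) : Set (ParamVal n) :=
  {v | ∀ c ∈ P, c.2.2.Holds (∑ j, (c.1 j : ℚ) * (v j : ℚ) + (c.2.1 : ℚ)) 0}

/-- A formalism for sets of parameter valuations: for each number `n` of parameters, a type of
finite descriptions and the set of valuations that each of them denotes. -/
structure Formalism where
  Code : ℕ → Type
  codable : ∀ n, Primcodable (Code n)
  denote : ∀ {n : ℕ}, Code n → Set (ParamVal n)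

attribute [instance] Formalism.codable

namespace Formalism

/-- The emptiness of the intersection of two sets is decidable from their descriptions. -/
def DecidesInterEmptiness (F : Formalism) : Prop :=
  ∀ n, ComputablePred fun c : F.Code n × F.Code n => F.denote c.1 ∩ F.denote c.2 = ∅

/-- Minimal-time reachability synthesis for L/U-PTAs is solved in the formalism: for all numbers of
clocks and of parameters there is an algorithm that turns every L/U-PTA and every set of its
locations into a description of the set of valuations that reach them in minimal time. (The
algorithm may differ from one pair of numbers to another.) -/
def SolvesMinTimeSynthLU (F : Formalism) : Prop :=
  ∀ k n, ∃ f : PTA k n × List ℕ → F.Code n, Computable f ∧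
    ∀ (A : PTA k n) (T : List ℕ), A.IsLUInstance T → F.denote (f (A, T)) = A.minTimeSynth T

/-- Polyhedra can be translated effectively into the formalism. -/
def ExpressesPolyhedra (F : Formalism) : Prop :=
  ∀ n, ∃ g : Polyhedron n → F.Code n, Computable g ∧ ∀ P, F.denote (g P) = P.toSet

end Formalism

/-! Emptiness of the intersection encodes the halting problem. Reachability is undecidable when
clocks can be compared with parameters for equality. In an L/U-PTA a test `x = p` has to be relaxed
to `p⁻ ≤ x ≤ p⁺`, with a lower-bound parameter `p⁻` and an upper-bound parameter `p⁺`. Passing it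
forces `p⁻ ≤ p⁺`. A second L/U-PTA in which the two have exchanged roles forces `p⁺ ≤ p⁻`, so on the
intersection of the two solution sets all these tests are equalities. Both automata enter their
target only when a clock that is never reset equals `1`; hence all successful runs take the same
time, and the synthesis set is the set of valuations with reachable target (`PTA.minTimeSynth_eq`).

Three pairs stand for numbers `s`, `q`, `i`; let `r = q - s`. The first automaton, `CounterPTA.aut`,
simulates one fixed counter program that searches for a zero of `haltTest m` (`Prog.exists_search`).
A counter with value `c` is stored as the excess `c * r` of its clock over a step clock. In a step
every counter clock is reset once, on reaching `s` or `q`, and the step lasts `s` or `q`. Duration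
minus reset value is `0`, `r` or `-r`: no change, increment or decrement. The input `m` enters
through `i = (m + 1) * r`. With equal bounds the simulation is sound for all values
(`simInv_of_run`), and for suitable small values every finite computation fits into one time unit
(`exists_inputVal`).

The second automaton, `ChainPTA.aut m`, checks `i = (m + 1) * r` by adding up `r`. The two synthesis
sets meet if and only if `haltTest m` has a zero, which gives the first statement. For the second,
the chain is replaced by a polyhedron, so that the first automaton alone is at fault. As to finite
unions of polyhedra, the accepted inputs include all `3 a + 1` and no `3 a + 2`; two inputs of the
first kind share a polyhedron, and convexity yields a forbidden one in between. -/

/-! Nondeterministic counter programs. -/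

/-- The elementary operations on counters: no operation, increment, decrement of a non-zero
counter, and zero test. -/
inductive CounterOp where
  | nop
  | inc (r : ℕ)
  | dec (r : ℕ)
  | zero (r : ℕ)
  deriving Encodable

/-- The effect of an operation on the counter values. -/
def CounterOp.Step : CounterOp → (ℕ → ℕ) → (ℕ → ℕ) → Prop
  | nop, σ, σ' => σ' = σ
  | inc r, σ, σ' => σ' = Function.update σ r (σ r + 1)
  | dec r, σ, σ' => σ r ≠ 0 ∧ σ' = Function.update σ r (σ r - 1)
  | zero r, σ, σ' => σ r = 0 ∧ σ' = σ

/-- Regular programs over counter operations. -/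
inductive Prog where
  | op (o : CounterOp)
  | seq (p q : Prog)
  | star (p : Prog)
  deriving Encodable

namespace Prog

open Function CounterOp

/-- The input-output relation of a program. -/
def Rel : Prog → (ℕ → ℕ) → (ℕ → ℕ) → Prop
  | op o => o.Step
  | seq p q => Relation.Comp p.Rel q.Rel
  | star p => Relation.ReflTransGen p.Rel

/-- From `σ`, the only possible result of `p` is `τ`. -/
def Det (p : Prog) (σ τ : ℕ → ℕ) : Prop := ∀ σ', p.Rel σ σ' ↔ σ' = τ

/-! ### Programs with a determined result. -/

theorem Det.seq {p q : Prog} {σ τ ρ : ℕ → ℕ} (hp : p.Det σ τ) (hq : q.Det τ ρ) :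
    (Prog.seq p q).Det σ ρ := fun σ' => by
  constructor
  · rintro ⟨τ', h1, h2⟩
    rw [(hp τ').1 h1] at h2
    exact (hq σ').1 h2
  · exact fun h => ⟨τ, (hp τ).2 rfl, (hq σ').2 h⟩

theorem Det.of_eq {p : Prog} {σ τ ρ : ℕ → ℕ} (hp : p.Det σ τ) (h : τ = ρ) : p.Det σ ρ := h ▸ hp

theorem det_nop (σ : ℕ → ℕ) : (op nop).Det σ σ := fun _ => Iff.rfl

theorem det_inc (r : ℕ) (σ : ℕ → ℕ) : (op (inc r)).Det σ (update σ r (σ r + 1)) :=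
  fun _ => Iff.rfl

/-- Repeat `p` as long as the counter `c` can be decremented. -/
def loop (c : ℕ) (p : Prog) : Prog := seq (star (seq (op (dec c)) p)) (op (zero c))

/-- The star may stop after any number of rounds, but the zero test rejects all exits before round
`N`, and the decrement blocks any further round. Here `s i` is the state before round `i`. -/
theorem det_loop {c : ℕ} {p : Prog} (s : ℕ → ℕ → ℕ) (N : ℕ) (hc : ∀ i ≤ N, s i c = N - i)
    (hp : ∀ i < N, p.Det (update (s i) c (N - i - 1)) (s (i + 1))) :
    (loop c p).Det (s 0) (s N) := fun σ' => by
  constructor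
  · rintro ⟨τ, h1, h2, rfl⟩
    have key : ∀ τ, (star (seq (op (dec c)) p)).Rel (s 0) τ → ∃ i ≤ N, τ = s i := by
      intro τ h
      induction h with
      | refl => exact ⟨0, Nat.zero_le _, rfl⟩
      | tail _ h ih =>
        obtain ⟨ρ, ⟨h3, rfl⟩, h4⟩ := h
        obtain ⟨i, hi, rfl⟩ := ih
        rw [hc i hi] at h3 h4
        exact ⟨i + 1, by omega, (hp i (by omega) _).1 h4⟩
    obtain ⟨i, hi, rfl⟩ := key _ h1
    rw [hc i hi] at h2
    rw [show i = N by omega]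
  · rintro rfl
    refine ⟨s N, ?_, by simp [hc], rfl⟩
    have key : ∀ i ≤ N, Relation.ReflTransGen (seq (op (dec c)) p).Rel (s 0) (s i) := by
      intro i
      induction i with
      | zero => exact fun _ => .refl
      | succ i ih =>
        intro hi
        refine (ih (by omega)).tail ⟨_, ⟨?_, rfl⟩, ?_⟩
        · rw [hc i (by omega)]; omega
        · rw [hc i (by omega)]; exact (hp i hi _).2 rfl
    exact key N le_rfl

/-- Set the counter `r` to zero. -/
def clear (r : ℕ) : Prog := loop r (op nop)

theorem det_clear (r : ℕ) (σ : ℕ → ℕ) : (clear r).Det σ (update σ r 0) := by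
  refine .of_eq (σ := σ) ?_ (?_ : update σ r (σ r - σ r) = _)
  · have := det_loop (c := r) (p := op nop) (fun i => update σ r (σ r - i)) (σ r)
      (fun i _ => by simp) (fun i hi => (det_nop _).of_eq (by simp [Nat.sub_sub]))
    simpa [clear] using this
  · simp

/-- Add the counter `a` to `b` and set it to zero. -/
def move (a b : ℕ) : Prog := loop a (op (inc b))

theorem det_move {a b : ℕ} (hab : a ≠ b) (σ : ℕ → ℕ) :
    (move a b).Det σ (update (update σ b (σ b + σ a)) a 0) := by
  have := det_loop (c := a) (p := op (inc b))
    (fun i => update (update σ b (σ b + i)) a (σ a - i)) (σ a)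
    (fun i _ => by simp) (fun i hi => (det_inc _ _).of_eq ?_)
  · simpa [move] using this
  · ext r
    simp only [update_apply]
    split_ifs <;> simp_all <;> omega

/-- Add the counter `a` to `b`, by means of the auxiliary counter `t`. -/
def copy (a b t : ℕ) : Prog :=
  seq (loop a (seq (op (inc b)) (op (inc t)))) (move t a)

theorem det_copy {a b t : ℕ} (hab : a ≠ b) (hat : a ≠ t) (hbt : b ≠ t) (σ : ℕ → ℕ)
    (ht : σ t = 0) : (copy a b t).Det σ (update σ b (σ b + σ a)) := by
  have h := det_loop (c := a) (p := seq (op (inc b)) (op (inc t)))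
    (fun i => update (update (update σ b (σ b + i)) t i) a (σ a - i)) (σ a)
    (fun i _ => by simp) (fun i hi => ((det_inc _ _).seq (det_inc _ _)).of_eq ?_)
  · refine Det.seq (τ := update (update (update σ b (σ b + σ a)) t (σ a)) a 0) ?_
      ((det_move hat.symm _).of_eq ?_)
    · refine Det.of_eq (τ := update (update (update σ b (σ b + σ a)) t (σ a)) a (σ a - σ a)) ?_
        (by simp)
      have h0 : σ = update (update (update σ b (σ b + 0)) t 0) a (σ a - 0) := by
        ext r; simp only [update_apply]; split_ifs <;> simp_all
      conv_lhs => rw [h0]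
      exact h
    · ext r
      simp only [update_apply]
      split_ifs <;> simp_all
  · ext r
    simp only [update_apply]
    split_ifs <;> simp_all <;> omega

/-- Set the counters `b, …, b + m - 1` to zero. -/
def clearRange (b : ℕ) : ℕ → Prog
  | 0 => op nop
  | m + 1 => seq (clearRange b m) (clear (b + m))

theorem det_clearRange (b m : ℕ) (σ : ℕ → ℕ) :
    (clearRange b m).Det σ (fun r => if b ≤ r ∧ r < b + m then 0 else σ r) := by
  induction m with
  | zero => exact (det_nop σ).of_eq (by ext r; rw [if_neg (by omega)])
  | succ m ih =>
    refine ih.seq ((det_clear _ _).of_eq ?_)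
    ext r
    simp only [update_apply]
    split_ifs <;> first | rfl | omega

/-! ### Counter programs for primitive recursive functions. -/

/-- `p` adds `f` of the counters `args` to the counter `out`, provided that the counters from `b`
on, which serve as auxiliary counters, are zero. -/
def Adds {n : ℕ} (p : Prog) (f : List.Vector ℕ n → ℕ) (args : Fin n → ℕ) (out b : ℕ) : Prop :=
  ∀ σ : ℕ → ℕ, (∀ r, b ≤ r → σ r = 0) →
    p.Det σ (update σ out (σ out + f (List.Vector.ofFn fun i => σ (args i))))

/-- The programs can add the values of `f` to a counter. -/
def Computes {n : ℕ} (f : List.Vector ℕ n → ℕ) : Prop :=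
  ∀ (args : Fin n → ℕ) (out b : ℕ), (∀ i, args i < b) → out < b → (∀ i, args i ≠ out) →
    ∃ p : Prog, p.Adds f args out b

/-- The values go into consecutive counters from `b` on, and auxiliary counters start only at `b +
m`. The arguments lie below `b`, so values already stored do not disturb later computations. -/
theorem exists_det_tuple {n m : ℕ} {g : Fin m → List.Vector ℕ n → ℕ} (hg : ∀ i, Computes (g i))
    (args : Fin n → ℕ) (b : ℕ) (hb : ∀ i, args i < b) (j : ℕ) (hj : j ≤ m) :
    ∃ p : Prog, ∀ σ : ℕ → ℕ, (∀ r, b ≤ r → σ r = 0) →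
      p.Det σ (fun r => if h : b ≤ r ∧ r < b + j then
        g ⟨r - b, by omega⟩ (List.Vector.ofFn fun i => σ (args i)) else σ r) := by
  induction j with
  | zero => exact ⟨op nop, fun σ _ => (det_nop σ).of_eq (by ext r; rw [dif_neg (by omega)])⟩
  | succ j ih =>
    obtain ⟨p, hp⟩ := ih (by omega)
    obtain ⟨q, hq⟩ := hg ⟨j, hj⟩ args (b + j) (b + m) (fun i => (hb i).trans_le (by omega))
      (by omega) (fun i => by have := hb i; omega)
    refine ⟨seq p q, fun σ hσ => (hp σ hσ).seq ((hq _ fun r hr => ?_).of_eq ?_)⟩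
    · rw [dif_neg (by omega)]
      exact hσ r (by omega)
    · ext r
      have harg : ∀ i, ¬ (b ≤ args i ∧ args i < b + j) := fun i => by have := hb i; omega
      simp only [update_apply, harg, dite_false]
      by_cases hr : r = b + j
      · subst hr
        simp [hσ (b + j) (by omega)]
      · rw [if_neg hr]
        by_cases h : b ≤ r ∧ r < b + j
        · rw [dif_pos h, dif_pos (by omega)]
        · rw [dif_neg h, dif_neg (by omega)]

/-- The inner values occupy a block of auxiliary counters, which is cleared at the end because
`Adds` allows no change outside `out`. -/
theorem Computes.comp {n m : ℕ} {f : List.Vector ℕ m → ℕ} (hf : Computes f)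
    {g : Fin m → List.Vector ℕ n → ℕ} (hg : ∀ i, Computes (g i)) :
    Computes fun v => f (List.Vector.ofFn fun i => g i v) := by
  intro args out b hb hout hne
  obtain ⟨p, hp⟩ := exists_det_tuple hg args b hb m le_rfl
  obtain ⟨q, hq⟩ := hf (fun i => b + i) out (b + m) (fun i => by omega) (by omega)
    (fun i => by omega)
  refine ⟨seq p (seq q (clearRange b m)), fun σ hσ =>
    (hp σ hσ).seq (((hq _ fun r hr => ?_)).seq ((det_clearRange _ _ _).of_eq ?_))⟩
  · rw [dif_neg (by omega)]
    exact hσ r (by omega)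
  · ext r
    simp only [update_apply]
    by_cases hr : r = out
    · subst hr
      have h : ¬ (b ≤ r ∧ r < b + m) := by omega
      simp [h]
    · rw [if_neg hr, if_neg hr]
      split_ifs with h
      · exact (hσ r h.1).symm
      · rfl

/-- A counted loop. `Computes` requires an output distinct from the arguments, so each round builds
the new value in a fresh counter and then moves it over the old one. -/
theorem Computes.prec {n : ℕ} {f : List.Vector ℕ n → ℕ} (hf : Computes f)
    {g : List.Vector ℕ (n + 2) → ℕ} (hg : Computes g) :
    Computes fun v : List.Vector ℕ (n + 1) =>
      v.head.rec (f v.tail) fun y IH => g (y ::ᵥ IH ::ᵥ v.tail) := by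
  intro args out b hb hout hne
  -- `b` is the recursion variable, `b + 1` the value, `b + 2` the new value, `b + 3` counts down
  obtain ⟨p, hp⟩ := hf (fun i => args i.succ) (b + 1) (b + 4)
    (fun i => (hb _).trans_le (by omega)) (by omega) (fun i => by have := hb i.succ; omega)
  obtain ⟨q, hq⟩ := hg (Fin.cons b (Fin.cons (b + 1) fun i => args i.succ)) (b + 2) (b + 4)
    (fun i => by
      refine Fin.cases (by simp) (fun i => ?_) i
      refine Fin.cases (by simp) (fun i => ?_) i
      have := hb i.succ
      simp only [Fin.cons_succ]; omega) (by omega)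
    (fun i => by
      refine Fin.cases (by simp) (fun i => ?_) i
      refine Fin.cases (by simp) (fun i => ?_) i
      have := hb i.succ
      simp only [Fin.cons_succ]; omega)
  refine ⟨seq p (seq (copy (args 0) (b + 3) (b + 4)) (seq
    (loop (b + 3) (seq q (seq (clear (b + 1)) (seq (move (b + 2) (b + 1)) (op (inc b))))))
    (seq (move (b + 1) out) (clear b)))), fun σ hσ => ?_⟩
  have hb0 := hb 0
  have hbs : ∀ i : Fin n, args i.succ < b := fun i => hb _
  set N := σ (args 0) with hN
  set w : List.Vector ℕ n := List.Vector.ofFn fun i => σ (args i.succ) with hw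
  let rec' : ℕ → ℕ := fun y => Nat.rec (f w) (fun y IH => g (y ::ᵥ IH ::ᵥ w)) y
  let s : ℕ → ℕ → ℕ := fun i =>
    update (update (update σ b i) (b + 1) (rec' i)) (b + 3) (N - i)
  have z0 := hσ b le_rfl
  have z1 := hσ (b + 1) (by omega)
  have z2 := hσ (b + 2) (by omega)
  have z3 := hσ (b + 3) (by omega)
  have z4 := hσ (b + 4) (by omega)
  refine (hp σ fun r hr => hσ r (by omega)).seq (((det_copy (by omega) (by omega) (by omega) _
    ?_).of_eq (τ := _) (ρ := s 0) ?_).seq ((det_loop s N ?_ fun i hi => ?_).seq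
      (((det_move (by omega) _).seq (det_clear _ _)).of_eq ?_)))
  · rw [update_of_ne (by omega)]; exact z4
  · ext r
    simp only [s, update_apply, z1, z3, zero_add, Nat.sub_zero]
    split_ifs <;> first | rfl | omega | (subst_vars; simp_all)
  · intro i hi
    simp [s]
  · refine (hq _ fun r hr => ?_).seq (((det_clear _ _).seq ((det_move (by omega) _).seq
      (det_inc _ _))).of_eq ?_)
    · simp only [s, update_apply]
      rw [if_neg (by omega), if_neg (by omega), if_neg (by omega), if_neg (by omega)]
      exact hσ r (by omega)
    · have harg : (List.Vector.ofFn fun j : Fin (n + 2) =>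
          update (s i) (b + 3) (N - i - 1)
            ((Fin.cons b (Fin.cons (b + 1) fun i => args i.succ) : Fin (n + 2) → ℕ) j)) =
          i ::ᵥ rec' i ::ᵥ w := by
        have h2 : ∀ j, update (s i) (b + 3) (N - i - 1) (args (Fin.succ j)) = σ (args j.succ) := by
          intro j
          have := hbs j
          simp only [s, update_apply]
          rw [if_neg (by omega), if_neg (by omega), if_neg (by omega), if_neg (by omega)]
        change _ ::ᵥ _ ::ᵥ List.Vector.ofFn
          (fun j => update (s i) (b + 3) (N - i - 1) (args (Fin.succ j))) = _
        simp only [h2, ← hw]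
        simp [s]
      rw [harg]
      have hr1 : rec' (i + 1) = g (i ::ᵥ rec' i ::ᵥ w) := rfl
      ext r
      simp only [s, update_apply, z2, hr1]
      split_ifs <;> first | rfl | omega | (subst_vars; simp_all)
  · ext r
    simp only [s, update_apply]
    split_ifs <;> first | rfl | omega | (subst_vars; simp_all)

theorem computes_of_primrec' {n : ℕ} {f : List.Vector ℕ n → ℕ} (hf : Nat.Primrec' f) :
    Computes f := by
  induction hf with
  | zero => exact fun args out b _ _ _ => ⟨op nop, fun σ _ => (det_nop σ).of_eq (by simp)⟩
  | succ =>
    intro args out b hb hout hne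
    have := hb 0
    refine ⟨seq (copy (args 0) out b) (op (inc out)), fun σ hσ =>
      ((det_copy (hne 0) (by omega) (by omega) σ (hσ b le_rfl)).seq (det_inc _ _)).of_eq ?_⟩
    simp [add_assoc]
  | get i =>
    intro args out b hb hout hne
    have := hb i
    exact ⟨copy (args i) out b, fun σ hσ =>
      (det_copy (hne i) (by omega) (by omega) σ (hσ b le_rfl)).of_eq (by simp)⟩
  | comp g _ _ hf hg => exact hf.comp hg
  | prec _ _ hf hg => exact hf.prec hg

/-- A program that searches for a zero of `F m`. -/
theorem exists_search {F : ℕ → ℕ → ℕ} (hF : Primrec₂ F) :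
    ∃ p : Prog, ∀ m, (∃ σ, p.Rel (update (fun _ => 0) 0 (m + 1)) σ) ↔ ∃ t, F m t = 0 := by
  obtain ⟨p, hp⟩ := computes_of_primrec' (Nat.Primrec'.prim_iff₂.2 hF) ![0, 1] 2 3
    (by decide) (by decide) (by decide)
  have h0 : ∀ m, (op (dec 0)).Det (update (fun _ => 0) 0 (m + 1)) (update (fun _ => 0) 0 m) := by
    intro m σ'
    change _ ∧ _ ↔ _
    simp
  let s : ℕ → ℕ → ℕ → ℕ := fun m t => update (update (fun _ => 0) 0 m) 1 t
  have hs : ∀ m t, (op (inc 1)).Det (s m t) (s m (t + 1)) := fun m t =>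
    (det_inc _ _).of_eq (by simp [s])
  -- This star has no exit test: it guesses `t`, and it is the only part of the program whose result
  -- is not determined.
  have h1 : ∀ m σ, (star (op (inc 1))).Rel (s m 0) σ ↔ ∃ t, σ = s m t := by
    refine fun m σ => ⟨fun h => ?_, ?_⟩
    · induction h with
      | refl => exact ⟨0, rfl⟩
      | tail _ h ih =>
        obtain ⟨t, rfl⟩ := ih
        exact ⟨t + 1, (hs m t _).1 h⟩
    · rintro ⟨t, rfl⟩
      induction t with
      | zero => exact .refl
      | succ t ih => exact ih.tail ((hs m t _).2 rfl)
  have h2 : ∀ m t, p.Det (s m t) (update (s m t) 2 (F m t)) := fun m t =>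
    (hp (s m t) fun r hr => by
      simp only [s, update_apply]
      rw [if_neg (by omega), if_neg (by omega)]).of_eq (by simp [s])
  -- The first decrement undoes the shift by which the input `m` is stored as `m + 1`; the last zero
  -- test accepts if `F m t = 0`.
  refine ⟨seq (op (dec 0)) (seq (star (op (inc 1))) (seq p (op (zero 2)))), fun m => ?_⟩
  have hs0 : update (fun _ => 0) 0 m = s m 0 := by
    ext r
    simp only [s, update_apply]
    split_ifs <;> omega
  constructor
  · rintro ⟨σ, σ₁, e1, σ₂, e2, σ₃, e3, e4, rfl⟩
    rw [(h0 m _).1 e1, hs0] at e2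
    obtain ⟨t, rfl⟩ := (h1 m _).1 e2
    rw [(h2 m t _).1 e3] at e4
    exact ⟨t, by simpa using e4⟩
  · rintro ⟨t, ht⟩
    exact ⟨_, _, (h0 m _).2 rfl, s m t, by rw [hs0]; exact (h1 m _).2 ⟨t, rfl⟩, _, (h2 m t _).2 rfl,
      by simpa using ht, rfl⟩

/-! Programs as finite graphs, whose nodes are the stacks of programs still to be executed. -/

/-- The input-output relation of the sequential execution of a list of programs. -/
def StackRel : List Prog → (ℕ → ℕ) → (ℕ → ℕ) → Prop
  | [], σ, σ' => σ' = σ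
  | p :: k, σ, σ' => Relation.Comp p.Rel (StackRel k) σ σ'

/-- The edges used by `p` when `k` is still to be executed after it. -/
def graph : Prog → List Prog → List (List Prog × CounterOp × List Prog)
  | op o, k => [(op o :: k, o, k)]
  | seq p q, k => (seq p q :: k, nop, p :: q :: k) :: (graph p (q :: k) ++ graph q k)
  | star p, k => (star p :: k, nop, k) :: (star p :: k, nop, p :: star p :: k) ::
      graph p (star p :: k)

/-- Soundness of a single edge, read backwards: a completion from its target stack yields one from
its source stack. For the second `star` edge, one more iteration is put in front. -/
theorem stackRel_of_mem_graph {p : Prog} {k : List Prog}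
    {e : List Prog × CounterOp × List Prog} (he : e ∈ graph p k) {σ τ ρ : ℕ → ℕ}
    (h : e.2.1.Step σ τ) (h' : StackRel e.2.2 τ ρ) : StackRel e.1 σ ρ := by
  induction p generalizing k with
  | op o =>
    obtain rfl := List.mem_singleton.1 he
    exact ⟨τ, h, h'⟩
  | seq p q hp hq =>
    rcases List.mem_cons.1 he with rfl | he
    · obtain rfl : τ = σ := h
      obtain ⟨τ₁, h1, τ₂, h2, h3⟩ := h'
      exact ⟨τ₂, ⟨τ₁, h1, h2⟩, h3⟩
    · rcases List.mem_append.1 he with he | he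
      exacts [hp he, hq he]
  | star p hp =>
    rcases List.mem_cons.1 he with rfl | he
    · obtain rfl : τ = σ := h
      exact ⟨τ, .refl, h'⟩
    · rcases List.mem_cons.1 he with rfl | he
      · obtain rfl : τ = σ := h
        obtain ⟨τ₁, h1, τ₂, h2, h3⟩ := h'
        exact ⟨τ₂, .head h1 h2, h3⟩
      · exact hp he

/-- Paths of a graph whose edges are labelled with counter operations. -/
inductive Path {V : Type} (E : List (V × CounterOp × V)) (a : V) (σ : ℕ → ℕ) :
    V → (ℕ → ℕ) → ℕ → Prop
  | refl : Path E a σ a σ 0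
  | tail {e : V × CounterOp × V} {τ ρ : ℕ → ℕ} {n : ℕ} :
      Path E a σ e.1 τ n → e ∈ E → e.2.1.Step τ ρ → Path E a σ e.2.2 ρ (n + 1)

theorem Path.trans {V : Type} {E : List (V × CounterOp × V)} {a b c : V} {σ τ ρ : ℕ → ℕ}
    {m n : ℕ} (h : Path E a σ b τ m) (h' : Path E b τ c ρ n) : ∃ l, Path E a σ c ρ l := by
  induction h' with
  | refl => exact ⟨m, h⟩
  | tail _ he hs ih =>
    obtain ⟨l, hl⟩ := ih
    exact ⟨_, hl.tail he hs⟩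

theorem Path.mono {V : Type} {E E' : List (V × CounterOp × V)} (hE : E ⊆ E') {a b : V}
    {σ τ : ℕ → ℕ} {n : ℕ} (h : Path E a σ b τ n) : Path E' a σ b τ n := by
  induction h with
  | refl => exact .refl
  | tail _ he hs ih => exact ih.tail (hE he) hs

/-- Completeness of the graph: an iteration of a star is a cycle through the node `star p :: k`. -/
theorem exists_path_of_rel {p : Prog} {k : List Prog} {σ τ : ℕ → ℕ} (h : p.Rel σ τ) :
    ∃ n, Path (graph p k) (p :: k) σ k τ n := by
  induction p generalizing k σ τ with
  | op o => exact ⟨1, Path.refl.tail (e := (op o :: k, o, k)) (by simp [graph]) h⟩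
  | seq p q hp hq =>
    obtain ⟨ρ, h1, h2⟩ := h
    obtain ⟨_, h1⟩ := hp (k := q :: k) h1
    obtain ⟨_, h2⟩ := hq (k := k) h2
    have h0 : Path (graph (seq p q) k) (seq p q :: k) σ (p :: q :: k) σ 1 :=
      Path.refl.tail (e := (_, nop, _)) (by simp [graph]) rfl
    obtain ⟨_, h3⟩ := h0.trans (h1.mono (E' := graph (seq p q) k)
      fun e he => by simp [graph, he])
    exact h3.trans (h2.mono fun e he => by simp [graph, he])
  | star p hp =>
    have key : ∃ n, Path (graph (star p) k) (star p :: k) σ (star p :: k) τ n := by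
      induction h with
      | refl => exact ⟨0, .refl⟩
      | tail _ h ih =>
        obtain ⟨_, ih⟩ := ih
        obtain ⟨_, h⟩ := hp (k := star p :: k) h
        have h0 := ih.tail (e := (star p :: k, nop, p :: star p :: k)) (by simp [graph]) rfl
        exact h0.trans (h.mono fun e he => by simp [graph, he])
    obtain ⟨_, key⟩ := key
    exact ⟨_, key.tail (e := (star p :: k, nop, k)) (by simp [graph]) rfl⟩

theorem stackRel_of_path {p : Prog} {k a b : List Prog} {σ τ : ℕ → ℕ} {n : ℕ}
    (h : Path (graph p k) a σ b τ n) {ρ : ℕ → ℕ} (hb : StackRel b τ ρ) : StackRel a σ ρ := by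
  induction h with
  | refl => exact hb
  | tail _ he hs ih => exact ih (stackRel_of_mem_graph he hs hb)

theorem exists_path_iff (p : Prog) (σ : ℕ → ℕ) :
    (∃ τ n, Path (graph p []) [p] σ [] τ n) ↔ ∃ τ, p.Rel σ τ := by
  constructor
  · rintro ⟨τ, n, h⟩
    obtain ⟨τ₁, h1, -⟩ := stackRel_of_path h (ρ := τ) rfl
    exact ⟨τ₁, h1⟩
  · rintro ⟨τ, h⟩
    exact ⟨τ, exists_path_of_rel h⟩

end Prog

/-! Minimal times, and runs of automata without invariants. -/

theorem MinVal.minimum_eq {S : Set MinVal} {m : MinVal} (h : IsGLB S m) : MinVal.minimum S = m :=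
  (MinVal.isGLB_minimum S).unique h

namespace PTA

variable {k n : ℕ}

/-- If the target is only reached in time `c`, and is reached for some valuation, then the minimal
time is attained by the valuations for which the target is reachable. -/
theorem minTimeSynth_eq {A : PTA k n} {T : List ℕ} {c : ℝ≥0}
    (h : ∀ v, ∀ t ∈ A.reachDurations v T, t = c) {v₀ : ParamVal n}
    (h₀ : (A.reachDurations v₀ T).Nonempty) :
    A.minTimeSynth T = {v | (A.reachDurations v T).Nonempty} := by
  have h1 : ∀ v, (A.reachDurations v T).Nonempty → A.minTimeReach v T = MinVal.exact c := by
    intro v hv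
    have : A.reachDurations v T = {c} := Set.eq_singleton_iff_nonempty_unique_mem.2 ⟨hv, h v⟩
    rw [minTimeReach, this, Set.image_singleton]
    exact MinVal.minimum_eq isGLB_singleton
  have h2 : ∀ v, ¬ (A.reachDurations v T).Nonempty → A.minTimeReach v T = ⊤ := by
    intro v hv
    rw [minTimeReach, Set.not_nonempty_iff_eq_empty.1 hv, Set.image_empty]
    exact MinVal.minimum_eq isGLB_empty
  -- Without `v₀` the minimum could be `∞`, and then the valuations with unreachable target would be
  -- the solutions.
  have h3 : A.minTimePTA T = MinVal.exact c := by
    refine MinVal.minimum_eq ⟨?_, fun m hm => hm ⟨v₀, h1 v₀ h₀⟩⟩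
    rintro _ ⟨v, rfl⟩
    by_cases hv : (A.reachDurations v T).Nonempty
    · exact (h1 v hv).ge
    · simp only [h2 v hv, le_top]
  ext v
  rw [minTimeSynth, Set.mem_ofPred_eq, Set.mem_ofPred_eq, h3]
  refine ⟨fun hv => ?_, h1 v⟩
  by_contra h'
  rw [h2 v h'] at hv
  exact absurd hv (by simp [MinVal.exact])

/-- An induction principle for runs. -/
theorem Run.invariant_induction {A : PTA k n} {v : ParamVal n} {P : ℕ → ClockVal k → ℝ≥0 → Prop}
    (init : P A.init (fun _ => 0) 0)
    (delay : ∀ l w t d, P l w t → P l (w.delay d) (t + d))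
    (edge : ∀ e ∈ A.edges, ∀ w t, P e.src w t → e.guard.Sat v w → P e.tgt (w.reset e.reset) t)
    {l : ℕ} {w : ClockVal k} {t : ℝ≥0} (h : A.Run v l w t) : P l w t := by
  induction h with
  | init => exact init
  | step _ _ h ih =>
    obtain ⟨he, rfl, rfl, -, -, hg, rfl⟩ := h
    exact edge _ he _ _ (delay _ _ _ _ ih) hg

/-- A state that is visited by a run after a delay. -/
def Visits (A : PTA k n) (v : ParamVal n) (l : ℕ) (w : ClockVal k) (t : ℝ≥0) : Prop :=
  ∃ w₀ t₀ d, A.Run v l w₀ t₀ ∧ w = w₀.delay d ∧ t = t₀ + d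

theorem Run.visits {A : PTA k n} {v : ParamVal n} {l : ℕ} {w : ClockVal k} {t : ℝ≥0}
    (h : A.Run v l w t) : A.Visits v l w t :=
  ⟨w, t, 0, h, by ext; simp [ClockVal.delay], by simp⟩

/-- Allows the duration of a successful run to be read off the guard of its last edge. -/
theorem Run.last {A : PTA k n} {v : ParamVal n} {l : ℕ} {w : ClockVal k} {t : ℝ≥0}
    (h : A.Run v l w t) :
    l = A.init ∨ ∃ e ∈ A.edges, e.tgt = l ∧ ∃ w₀, A.Visits v e.src w₀ t ∧ e.guard.Sat v w₀ := by
  cases h with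
  | init => exact .inl rfl
  | step h _ h' =>
    obtain ⟨he, rfl, rfl, -, -, hg, -⟩ := h'
    exact .inr ⟨_, he, rfl, _, ⟨_, _, _, h, rfl, rfl⟩, hg⟩

theorem Visits.delay {A : PTA k n} {v : ParamVal n} {l : ℕ} {w : ClockVal k} {t : ℝ≥0}
    (h : A.Visits v l w t) (d : ℝ≥0) : A.Visits v l (w.delay d) (t + d) := by
  obtain ⟨w₀, t₀, d₀, h, rfl, rfl⟩ := h
  exact ⟨w₀, t₀, d₀ + d, h, by ext; simp [ClockVal.delay, add_assoc], by rw [add_assoc]⟩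

theorem isState_of_inv_nil {A : PTA k n} (hA : ∀ g ∈ A.inv, g = []) {v : ParamVal n} {l : ℕ}
    (hl : l < A.numLoc) (w : ClockVal k) : A.IsState v l w := by
  refine ⟨hl, ?_⟩
  have : A.invariant l = [] := by
    rw [invariant, List.getD_eq_getElem _ _ hl]
    exact hA _ (List.getElem_mem hl)
  rw [this]
  exact fun a ha => absurd ha (by simp)

/-- Without invariants every delay is allowed, so only the guard remains to be checked. -/
theorem Visits.edge {A : PTA k n} (hA : ∀ g ∈ A.inv, g = []) (hwf : A.WellFormed)
    {v : ParamVal n} {w : ClockVal k} {t : ℝ≥0} {e : Edge k n} (h : A.Visits v e.src w t)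
    (he : e ∈ A.edges) (hg : e.guard.Sat v w) : A.Run v e.tgt (w.reset e.reset) t := by
  obtain ⟨w₀, t₀, d, h, rfl, rfl⟩ := h
  have h1 := hwf.edges_lt e he
  exact h.step (fun d' _ => isState_of_inv_nil hA h1.1 _)
    ⟨he, rfl, rfl, isState_of_inv_nil hA h1.1 _, isState_of_inv_nil hA h1.2.2 _, hg, rfl⟩

theorem run_init {A : PTA k n} (hA : ∀ g ∈ A.inv, g = []) (hwf : A.WellFormed)
    (v : ParamVal n) : A.Run v A.init (fun _ => 0) 0 :=
  .init (isState_of_inv_nil hA hwf.init_lt _)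

end PTA

/-! Guards of the form `p ≤ x ≤ p'`. -/

namespace Guard

variable {k n : ℕ}

/-- The guard `p ≤ x ≤ p'`, for a pair `(p, p')` of parameters. -/
def between (x : Fin k) (p : Fin n × Fin n) : Guard k n :=
  [⟨x, .ge, .inr p.1⟩, ⟨x, .le, .inr p.2⟩]

theorem between_sat {x : Fin k} {p : Fin n × Fin n} {v : ParamVal n} {w : ClockVal k} :
    (between x p).Sat v w ↔ ((v p.1 : ℚ≥0) : ℝ≥0) ≤ w x ∧ w x ≤ ((v p.2 : ℚ≥0) : ℝ≥0) := by
  simp [between, Guard.Sat, Atom.Sat, Atom.boundVal, Cmp.Holds]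

theorem sat_append {g g' : Guard k n} {v : ParamVal n} {w : ClockVal k} :
    Guard.Sat (g ++ g') v w ↔ g.Sat v w ∧ g'.Sat v w := by
  simp [Guard.Sat, or_imp, forall_and]

/-- The guard `x ⋈ d`. -/
def const (x : Fin k) (c : Cmp) (d : ℕ) : Guard k n := [⟨x, c, .inl d⟩]

theorem const_sat {x : Fin k} {c : Cmp} {d : ℕ} {v : ParamVal n} {w : ClockVal k} :
    (const x c d).Sat v w ↔ c.Holds (w x) (d : ℝ≥0) := by
  simp [const, Guard.Sat, Atom.Sat, Atom.boundVal]

/-- The parameters of a guard of which some are lower bounds and the others are upper bounds. -/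
def LU (L : Set (Fin n)) (g : Guard k n) : Prop :=
  ∀ a ∈ g, ∀ p : Fin n, a.bound = Sum.inr p →
    (p ∈ L ∧ (a.cmp = Cmp.ge ∨ a.cmp = Cmp.gt)) ∨ (p ∉ L ∧ (a.cmp = Cmp.le ∨ a.cmp = Cmp.lt))

theorem lu_nil (L : Set (Fin n)) : LU L ([] : Guard k n) := fun a ha => absurd ha (by simp)

theorem lu_const (L : Set (Fin n)) (x : Fin k) (c : Cmp) (d : ℕ) : LU L (const x c d) := by
  simp [LU, const]

theorem lu_between {L : Set (Fin n)} (x : Fin k) {p : Fin n × Fin n} (h1 : p.1 ∈ L)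
    (h2 : p.2 ∉ L) : LU L (between x p) := by
  simp [LU, between, h1, h2]

theorem LU.append {L : Set (Fin n)} {g g' : Guard k n} (h : LU L g) (h' : LU L g') :
    LU L (g ++ g') := fun a ha =>
  (List.mem_append.1 ha).elim (h a) (h' a)

end Guard

/-- Clocks are addressed by natural numbers through `f`; injectivity below `N` keeps a reset from
affecting other clocks. -/
theorem ClockVal.reset_map {k : ℕ} {f : ℕ → Fin k} {N : ℕ}
    (hf : ∀ i j, i < N → j < N → f i = f j → i = j) {l : List ℕ} (hl : ∀ i ∈ l, i < N) {j : ℕ}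
    (hj : j < N) (w : ClockVal k) :
    w.reset (l.map f) (f j) = if j ∈ l then 0 else w (f j) := by
  have : f j ∈ l.map f ↔ j ∈ l := by
    refine ⟨fun h => ?_, List.mem_map_of_mem⟩
    obtain ⟨i, hi, hij⟩ := List.mem_map.1 h
    exact hf i j (hl i hi) hj hij ▸ hi
  simp only [ClockVal.reset, this]

/-! The automaton that simulates a counter program. Its parameters are `s`, `q` and `i`, each
represented by a lower-bound and an upper-bound parameter. The value `c` of a counter is represented
by the clock value `c * (q - s)`. -/

namespace CounterPTA

open Function

def sPar : Fin 6 × Fin 6 := (0, 1)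
def qPar : Fin 6 × Fin 6 := (2, 3)
def iPar : Fin 6 × Fin 6 := (4, 5)

/-- The lower-bound parameters. -/
def lower : Set (Fin 6) := {0, 2, 4}

/-- The clocks of the `k` counters, followed by a clock that measures the duration of a step and a
clock that measures the total time. -/
def clk (k j : ℕ) : Fin (k + 2) := Fin.ofNat (k + 2) j

theorem clk_inj (k i j : ℕ) (hi : i < k + 2) (hj : j < k + 2) (h : clk k i = clk k j) : i = j := by
  have := congrArg Fin.val h
  simpa [clk, Nat.mod_eq_of_lt hi, Nat.mod_eq_of_lt hj] using this

/-- The edges of the graph of a program. -/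
abbrev GEdge : Type := List Prog × CounterOp × List Prog

/-- The locations. In `mid e R`, the simulation of `e` is in progress, and the clocks of the
counters in `R` have been reset. -/
inductive Loc where
  | init₀
  | init₁
  | init₂
  | node (a : List Prog)
  | mid (e : GEdge) (R : Finset ℕ)
  | target
  deriving Encodable

/-- The value at which the clock of a counter is reset in the simulation of an operation. -/
def thr : CounterOp → ℕ → Fin 6 × Fin 6
  | .inc r, j => if j = r then sPar else qPar
  | .dec r, j => if j = r then qPar else sPar
  | _, _ => qPar

/-- The duration of the simulation of an operation. -/
def dur : CounterOp → Fin 6 × Fin 6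
  | .dec _ => sPar
  | _ => qPar

/-- The condition under which the simulation of an operation starts. -/
def opGuard (k : ℕ) : CounterOp → Guard (k + 2) 6
  | .zero r => Guard.const (clk k k) .eq 0 ++ Guard.const (clk k r) .eq 0
  | _ => []

/-- Edges before the encoding of locations and clocks by numbers. -/
structure LEdge (k : ℕ) where
  src : Loc
  guard : Guard (k + 2) 6
  reset : List ℕ
  tgt : Loc

/-- The edges that simulate an operation. -/
noncomputable def stepEdges (k : ℕ) (e : GEdge) : List (LEdge k) :=
  [⟨.node e.1, opGuard k e.2.1, [], .mid e ∅⟩,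
    ⟨.mid e (Finset.range k), Guard.between (clk k k) (dur e.2.1), [k], .node e.2.2⟩] ++
  (Finset.range k).powerset.toList.flatMap fun R =>
    (Finset.range k \ R).toList.map fun j =>
      ⟨.mid e R, Guard.between (clk k j) (thr e.2.1 j), [j], .mid e (insert j R)⟩

/-- All edges. -/
noncomputable def ledges (k : ℕ) (p : Prog) : List (LEdge k) :=
  [⟨.init₀, Guard.between (clk k k) sPar, [0], .init₁⟩,
    ⟨.init₁, Guard.between (clk k k) qPar ++ Guard.const (clk k 0) .gt 0, List.range (k + 1),
      .init₂⟩,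
    ⟨.init₂, Guard.between (clk k 0) iPar, (List.range k).map Nat.succ, .node [p]⟩,
    ⟨.node [], Guard.const (clk k (k + 1)) .eq 1, [], .target⟩] ++
  (p.graph []).flatMap (stepEdges k)

open Encodable in
/-- A number that is larger than those of all locations. -/
noncomputable def numLoc (k : ℕ) (p : Prog) : ℕ :=
  encode Loc.init₀ + encode Loc.target +
    ((ledges k p).map fun e => encode e.src + encode e.tgt).sum + 1

/-- The automaton that simulates `p`, with clocks for `k` counters. -/
noncomputable def aut (k : ℕ) (p : Prog) : PTA (k + 2) 6 where
  numAct := 1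
  init := Encodable.encode Loc.init₀
  inv := List.replicate (numLoc k p) []
  edges := (ledges k p).map fun e =>
    ⟨Encodable.encode e.src, e.guard, 0, e.reset.map (clk k), Encodable.encode e.tgt⟩

/-- The target. -/
def goal : List ℕ := [Encodable.encode Loc.target]

theorem mem_ledges {k : ℕ} {p : Prog} {e : LEdge k} (he : e ∈ ledges k p) :
    e = ⟨.init₀, Guard.between (clk k k) sPar, [0], .init₁⟩ ∨
    e = ⟨.init₁, Guard.between (clk k k) qPar ++ Guard.const (clk k 0) .gt 0, List.range (k + 1),
      .init₂⟩ ∨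
    e = ⟨.init₂, Guard.between (clk k 0) iPar, (List.range k).map Nat.succ, .node [p]⟩ ∨
    e = ⟨.node [], Guard.const (clk k (k + 1)) .eq 1, [], .target⟩ ∨
    ∃ g ∈ p.graph [], e = ⟨.node g.1, opGuard k g.2.1, [], .mid g ∅⟩ ∨
      e = ⟨.mid g (Finset.range k), Guard.between (clk k k) (dur g.2.1), [k], .node g.2.2⟩ ∨
      ∃ (R : Finset ℕ) (j : ℕ), j < k ∧ j ∉ R ∧
        e = ⟨.mid g R, Guard.between (clk k j) (thr g.2.1 j), [j], .mid g (insert j R)⟩ := by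
  simp only [ledges, stepEdges, List.mem_append, List.mem_cons, List.not_mem_nil, or_false,
    List.mem_flatMap, List.mem_map, Finset.mem_toList, Finset.mem_sdiff, Finset.mem_range] at he
  rcases he with (h | h | h | h) | ⟨g, hg, (h | h) | ⟨R, hR, j, ⟨hj, hjR⟩, h⟩⟩
  · exact .inl h
  · exact .inr (.inl h)
  · exact .inr (.inr (.inl h))
  · exact .inr (.inr (.inr (.inl h)))
  · exact .inr (.inr (.inr (.inr ⟨g, hg, .inl h⟩)))
  · exact .inr (.inr (.inr (.inr ⟨g, hg, .inr (.inl h)⟩)))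
  · exact .inr (.inr (.inr (.inr ⟨g, hg, .inr (.inr ⟨R, j, hj, hjR, h.symm⟩)⟩)))

theorem le_sum_map_of_mem {k : ℕ} {e : LEdge k} (l : List (LEdge k)) (he : e ∈ l) (f : LEdge k → ℕ) :
    f e ≤ (l.map f).sum :=
  List.le_sum_of_mem (List.mem_map_of_mem he)

theorem wellFormed (k : ℕ) (p : Prog) : (aut k p).WellFormed where
  init_lt := by simp only [aut, PTA.numLoc, List.length_replicate, numLoc]; omega
  edges_lt e he := by
    obtain ⟨e, hmem, rfl⟩ := List.mem_map.1 he
    have := le_sum_map_of_mem _ hmem fun e => Encodable.encode e.src + Encodable.encode e.tgt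
    simp only [aut, PTA.numLoc, List.length_replicate, numLoc]
    exact ⟨by omega, by omega, by omega⟩

/-- Parameters occur only in `between` guards, always as a pair with its lower-bound member first.
-/
theorem isLUInstance (k : ℕ) (p : Prog) : (aut k p).IsLUInstance goal where
  wellFormed := wellFormed k p
  isLU := by
    refine ⟨lower, fun g hg => ?_⟩
    change Guard.LU lower g
    have hs (x : Fin (k + 2)) : Guard.LU lower (Guard.between x sPar) :=
      Guard.lu_between x (by simp [lower, sPar]) (by simp [lower, sPar])
    have hq (x : Fin (k + 2)) : Guard.LU lower (Guard.between x qPar) :=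
      Guard.lu_between x (by simp [lower, qPar]) (by simp [lower, qPar])
    have hi (x : Fin (k + 2)) : Guard.LU lower (Guard.between x iPar) :=
      Guard.lu_between x (by simp [lower, iPar]) (by simp [lower, iPar])
    rcases List.mem_append.1 hg with hg | hg
    · obtain rfl := List.eq_of_mem_replicate hg
      exact Guard.lu_nil _
    · obtain ⟨_, he, rfl⟩ := List.mem_map.1 hg
      obtain ⟨e, hmem, rfl⟩ := List.mem_map.1 he
      rcases mem_ledges hmem with rfl | rfl | rfl | rfl | ⟨g, -, rfl | rfl | ⟨R, j, -, -, rfl⟩⟩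
      · exact hs _
      · exact (hq _).append (Guard.lu_const _ _ _ _)
      · exact hi _
      · exact Guard.lu_const _ _ _ _
      · dsimp only
        cases g.2.1
        case zero => exact (Guard.lu_const _ _ _ _).append (Guard.lu_const _ _ _ _)
        all_goals exact Guard.lu_nil _
      · dsimp only
        cases g.2.1
        case dec => exact hs _
        all_goals exact hq _
      · dsimp only
        cases g.2.1 <;> simp only [thr] <;> (try split_ifs) <;> first | exact hs _ | exact hq _
  target_lt l hl := by
    obtain rfl := List.mem_singleton.1 hl
    simp only [aut, PTA.numLoc, List.length_replicate, numLoc]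
    omega

theorem inv_nil (k : ℕ) (p : Prog) : ∀ g ∈ (aut k p).inv, g = [] := fun _ hg =>
  List.eq_of_mem_replicate hg

/-- In particular clock `k + 1` is never reset, so it shows the total time. -/
theorem reset_lt {k : ℕ} {p : Prog} {e : LEdge k} (he : e ∈ ledges k p) :
    ∀ i ∈ e.reset, i < k + 1 := by
  rcases mem_ledges he with rfl | rfl | rfl | rfl | ⟨g, -, rfl | rfl | ⟨R, j, hj, -, rfl⟩⟩ <;>
    first | (simp; done) | (simp; omega)

/-- An induction principle for runs of the automaton. -/
theorem run_induction {k : ℕ} {p : Prog} {v : ParamVal 6}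
    {P : Loc → (ℕ → ℝ≥0) → ℝ≥0 → Prop} (hP : ∀ L W W' t, (∀ j < k + 2, W j = W' j) →
      P L W t → P L W' t)
    (init : P .init₀ (fun _ => 0) 0)
    (delay : ∀ L W t d, P L W t → P L (fun j => W j + d) (t + d))
    (edge : ∀ e ∈ ledges k p, ∀ w : ClockVal (k + 2), ∀ t, P e.src (fun j => w (clk k j)) t →
      e.guard.Sat v w → P e.tgt (fun j => if j ∈ e.reset then 0 else w (clk k j)) t)
    {l : ℕ} {w : ClockVal (k + 2)} {t : ℝ≥0} (h : (aut k p).Run v l w t) :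
    ∃ L, Encodable.encode L = l ∧ P L (fun j => w (clk k j)) t := by
  refine PTA.Run.invariant_induction (P := fun l w t =>
    ∃ L, Encodable.encode L = l ∧ P L (fun j => w (clk k j)) t) ⟨_, rfl, init⟩ ?_ ?_ h
  · rintro _ w t d ⟨L, rfl, hL⟩
    exact ⟨L, rfl, delay _ _ _ _ hL⟩
  · intro e he w t ⟨L, hL, h⟩ hg
    obtain ⟨e, hmem, rfl⟩ := List.mem_map.1 he
    obtain rfl := Encodable.encode_injective hL
    -- `clk` wraps around from `k + 2` on, so the two descriptions of the clocks after the reset are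
    -- compared only below `k + 2`; `hP` makes this sufficient.
    refine ⟨_, rfl, hP _ _ _ _ (fun j hj => ?_) (edge e hmem w t h hg)⟩
    exact (ClockVal.reset_map (clk_inj k) (fun i hi => (reset_lt hmem i hi).trans (by omega)) hj w).symm

end CounterPTA

/-! ### Soundness of the simulation: what a run implies. -/

namespace CounterPTA

open Function

/-- What is known about the parameters and the total time at a location. -/
theorem bounds_of_run {k : ℕ} (hk : 0 < k) {p : Prog} {v : ParamVal 6} {l : ℕ} {w : ClockVal (k + 2)}
    {t : ℝ≥0} (h : (aut k p).Run v l w t) :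
    ∃ L : Loc, Encodable.encode L = l ∧ w (clk k (k + 1)) = t ∧
      (L = .init₁ → ((v 0 : ℚ≥0) : ℝ≥0) ≤ w (clk k k)) ∧ (L ≠ .init₀ → v 0 ≤ v 1 ∧
      (L ≠ .init₁ → v 2 ≤ v 3 ∧ v 0 ≤ v 3 ∧ (L ≠ .init₂ → v 4 ≤ v 5))) := by
  refine run_induction (P := fun L W t => W (k + 1) = t ∧
      (L = .init₁ → ((v 0 : ℚ≥0) : ℝ≥0) ≤ W k) ∧ (L ≠ .init₀ → v 0 ≤ v 1 ∧
      (L ≠ .init₁ → v 2 ≤ v 3 ∧ v 0 ≤ v 3 ∧ (L ≠ .init₂ → v 4 ≤ v 5)))) ?_ ?_ ?_ ?_ h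
  · intro L W W' t hW ⟨h1, h2⟩
    rw [← hW k (by omega)]
    exact ⟨(hW (k + 1) (by omega)).symm.trans h1, h2⟩
  · simp
  · rintro L W _ d ⟨rfl, h, h'⟩
    exact ⟨rfl, fun hL => (h hL).trans le_self_add, h'⟩
  · intro e he w t ⟨h1, h2, h3⟩ hg
    have cast {a b : Fin 6} {x : ℝ≥0} (h : ((v a : ℚ≥0) : ℝ≥0) ≤ x)
        (h' : x ≤ ((v b : ℚ≥0) : ℝ≥0)) : v a ≤ v b := by exact_mod_cast h.trans h'
    refine ⟨(if_neg fun h => absurd (reset_lt he (k + 1) h) (lt_irrefl _)).trans h1, ?_⟩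
    rcases mem_ledges he with rfl | rfl | rfl | rfl | ⟨g, -, rfl | rfl | ⟨R, j, -, -, rfl⟩⟩
    · have hg := Guard.between_sat.1 hg
      have := cast hg.1 hg.2
      have := hk.ne'
      simp_all [sPar]
    · have hg := Guard.between_sat.1 (Guard.sat_append.1 hg).1
      have := cast hg.1 hg.2
      -- The step clock is at least `v 0` throughout `init₁`, since it is not reset on entry. It
      -- thus links the lower bound of `s` with the upper bound of `q`.
      have := cast (h2 rfl) hg.2
      simp_all [qPar]
    · have hg := Guard.between_sat.1 hg
      have := cast hg.1 hg.2
      simp_all [iPar]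
    all_goals simp_all

/-- The assumption that the bounds of each parameter are equal, with `q = s + r`. -/
structure Exact (v : ParamVal 6) (s r : ℝ≥0) (m : ℕ) : Prop where
  s_eq : ((v 0 : ℚ≥0) : ℝ≥0) = s ∧ ((v 1 : ℚ≥0) : ℝ≥0) = s
  q_eq : ((v 2 : ℚ≥0) : ℝ≥0) = s + r ∧ ((v 3 : ℚ≥0) : ℝ≥0) = s + r
  i_eq : ((v 4 : ℚ≥0) : ℝ≥0) = (m + 1) * r ∧ ((v 5 : ℚ≥0) : ℝ≥0) = (m + 1) * r

/-- The initial counter values. -/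
def start (m : ℕ) : ℕ → ℕ := update (fun _ => 0) 0 (m + 1)

/-- A bound on the counters that occur in an operation. -/
def regBound : CounterOp → ℕ
  | .nop => 0
  | .inc r | .dec r | .zero r => r + 1

/-- The reset value of a counter as a real number. -/
noncomputable def thrVal (s r : ℝ≥0) : CounterOp → ℕ → ℝ≥0
  | .inc c, j => if j = c then s else s + r
  | .dec c, j => if j = c then s + r else s
  | _, _ => s + r

/-- The duration of an operation as a real number. -/
noncomputable def durVal (s r : ℝ≥0) : CounterOp → ℝ≥0
  | .dec _ => s
  | _ => s + r

theorem Exact.thr_sat {v : ParamVal 6} {s r : ℝ≥0} {m : ℕ} (hv : Exact v s r m) {k : ℕ}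
    {x : Fin k} {w : ClockVal k} (o : CounterOp) (j : ℕ) :
    (Guard.between x (thr o j)).Sat v w ↔ w x = thrVal s r o j := by
  rw [Guard.between_sat, eq_comm, le_antisymm_iff]
  cases o <;> simp only [thr, thrVal] <;> (try split_ifs) <;>
    simp [sPar, qPar, hv.s_eq, hv.q_eq]

theorem Exact.dur_sat {v : ParamVal 6} {s r : ℝ≥0} {m : ℕ} (hv : Exact v s r m) {k : ℕ}
    {x : Fin k} {w : ClockVal k} (o : CounterOp) :
    (Guard.between x (dur o)).Sat v w ↔ w x = durVal s r o := by
  rw [Guard.between_sat, eq_comm, le_antisymm_iff]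
  cases o <;> simp [dur, durVal, sPar, qPar, hv.s_eq, hv.q_eq]

/-- The effect of an operation on the clock of a counter. -/
theorem exists_step {s r : ℝ≥0} (hr : 0 < r) {k : ℕ} {o : CounterOp} (ho : regBound o ≤ k)
    {c : ℕ → ℕ} (hz : ∀ j, o = .zero j → c j = 0) {x : ℕ → ℝ≥0}
    (hx : ∀ j < k, x j + thrVal s r o j = c j * r + durVal s r o) :
    ∃ c', o.Step c c' ∧ ∀ j < k, x j = c' j * r := by
  cases o with
  | nop => exact ⟨c, rfl, fun j hj => add_right_cancel (hx j hj)⟩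
  | zero a => exact ⟨c, ⟨hz a rfl, rfl⟩, fun j hj => add_right_cancel (hx j hj)⟩
  | inc a =>
    refine ⟨_, rfl, fun j hj => ?_⟩
    have h := hx j hj
    simp only [thrVal, durVal] at h
    by_cases hja : j = a
    · subst hja
      rw [if_pos rfl, ← add_assoc, add_right_comm] at h
      simpa [add_mul] using add_right_cancel h
    · rw [if_neg hja] at h
      simpa [hja] using add_right_cancel h
  | dec a =>
    have ha : a < k := ho
    have h := hx a ha
    simp only [thrVal, durVal, if_true] at h
    rw [← add_assoc, add_right_comm] at h
    have h := add_right_cancel h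
    -- The clock of the decremented counter must reach `s + r` within a step of length `s`, which is
    -- impossible from the value `0`. So no explicit test for non-zero is needed.
    obtain ⟨b, hb⟩ : ∃ b, c a = b + 1 := by
      refine Nat.exists_eq_succ_of_ne_zero fun h0 => ?_
      rw [h0] at h
      simp [hr.ne'] at h
    refine ⟨_, ⟨by omega, rfl⟩, fun j hj => ?_⟩
    by_cases hja : j = a
    · subst hja
      rw [hb, Nat.cast_add, add_mul, Nat.cast_one, one_mul] at h
      simpa [hb] using add_right_cancel h
    · have h := hx j hj
      simp only [thrVal, durVal, if_neg hja] at h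
      simpa [hja] using add_right_cancel h

/-- What is known at a location if the bounds of each parameter are equal. -/
def SimInv (k : ℕ) (p : Prog) (s r : ℝ≥0) (m : ℕ) (W : ℕ → ℝ≥0) : Loc → Prop
  | .init₀ => ∀ j ≤ k, W j = W k
  | .init₁ => W k = W 0 + s
  | .init₂ => 0 < r ∧ ∀ j ≤ k, W j = W k
  | .node a => 0 < r ∧ ∃ c n, Prog.Path (p.graph []) [p] (start m) a c n ∧
      ∀ j < k, W j = c j * r + W k
  | .mid e R => 0 < r ∧ e ∈ p.graph [] ∧ ∃ c n, Prog.Path (p.graph []) [p] (start m) e.1 c n ∧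
      (∀ j, e.2.1 = .zero j → c j = 0) ∧ (∀ j < k, j ∉ R → W j = c j * r + W k) ∧
      ∀ j < k, j ∈ R → W j + thrVal s r e.2.1 j = c j * r + W k
  | .target => 0 < r ∧ ∃ c n, Prog.Path (p.graph []) [p] (start m) [] c n

/-- The clock relations in `SimInv` concern differences of clocks and so survive delays. A reset at
the value `thrVal` turns the relation for pending clocks into the one for clocks already reset, and
at the end of a step `exists_step` reads off the new counters. -/
theorem simInv_of_run {k : ℕ} (hk : 0 < k) {p : Prog} (hp : ∀ e ∈ p.graph [], regBound e.2.1 ≤ k)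
    {v : ParamVal 6} {s r : ℝ≥0} {m : ℕ} (hv : Exact v s r m) {l : ℕ} {w : ClockVal (k + 2)}
    {t : ℝ≥0} (h : (aut k p).Run v l w t) :
    ∃ L, Encodable.encode L = l ∧ SimInv k p s r m (fun j => w (clk k j)) L := by
  refine run_induction (P := fun L W t => SimInv k p s r m W L) ?_ ?_ ?_ ?_ h
  · intro L W W' t hW h
    have hWk := hW k (by omega)
    have hW0 := hW 0 (by omega)
    have hWj : ∀ j < k, W j = W' j := fun j hj => hW j (by omega)
    have hWj' : ∀ j ≤ k, W j = W' j := fun j hj => hW j (by omega)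
    cases L with
    | init₀ => exact fun j hj => by rw [← hWj' j hj, ← hWk]; exact h j hj
    | init₁ => simpa only [SimInv, hWk, hW0] using h
    | init₂ => exact ⟨h.1, fun j hj => by rw [← hWj' j hj, ← hWk]; exact h.2 j hj⟩
    | node a =>
      obtain ⟨hr, c, n, hc, h⟩ := h
      exact ⟨hr, c, n, hc, fun j hj => by rw [← hWj j hj, ← hWk]; exact h j hj⟩
    | mid e R =>
      obtain ⟨hr, he, c, n, hc, hz, h, h'⟩ := h
      exact ⟨hr, he, c, n, hc, hz, fun j hj hR => by rw [← hWj j hj, ← hWk]; exact h j hj hR,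
        fun j hj hR => by rw [← hWj j hj, ← hWk]; exact h' j hj hR⟩
    | target => exact h
  · intro j _
    rfl
  · intro L W t d h
    cases L with
    | init₀ => exact fun j hj => congrArg (· + d) (h j hj)
    | init₁ => exact (congrArg (· + d) h).trans (add_right_comm _ _ _)
    | init₂ => exact ⟨h.1, fun j hj => congrArg (· + d) (h.2 j hj)⟩
    | node a =>
      obtain ⟨hr, c, n, hc, h⟩ := h
      exact ⟨hr, c, n, hc, fun j hj => by simp only [h j hj, add_assoc]⟩
    | mid e R =>
      obtain ⟨hr, he, c, n, hc, hz, h, h'⟩ := h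
      exact ⟨hr, he, c, n, hc, hz, fun j hj hR => by simp only [h j hj hR, add_assoc],
        fun j hj hR => by rw [add_right_comm, h' j hj hR, add_assoc]⟩
    | target => exact h
  · intro e he w t h hg
    rcases mem_ledges he with rfl | rfl | rfl | rfl | ⟨g, hgE, rfl | rfl | ⟨R, j, hj, hjR, rfl⟩⟩
    · rw [Guard.between_sat] at hg
      simp only [sPar, hv.s_eq] at hg
      have := le_antisymm hg.1 hg.2
      simp [SimInv, this, hk.ne']
    · rw [Guard.sat_append, Guard.between_sat, Guard.const_sat] at hg
      obtain ⟨h1, h2⟩ := hg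
      simp only [qPar, hv.q_eq] at h1
      have h1 := le_antisymm h1.1 h1.2
      -- Clock `0` was reset when the step clock showed `s`. When the latter shows `s + r`, clock
      -- `0` shows `r`, which the guard requires to be positive.
      have h3 : w (clk k k) = w (clk k 0) + s := h
      rw [← h1, add_comm] at h3
      have h3 : r = w (clk k 0) := add_right_cancel h3
      refine ⟨by rw [h3]; simpa [Cmp.Holds] using h2, fun j hj => ?_⟩
      simp [Nat.lt_succ_of_le hj]
    · rw [Guard.between_sat] at hg
      simp only [iPar, hv.i_eq] at hg
      have hg := le_antisymm hg.1 hg.2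
      refine ⟨h.1, _, _, .refl, fun j hj => ?_⟩
      -- The edge resets the clocks `1, …, k`: the step clock and all counters except counter `0`,
      -- which keeps the value `(m + 1) * r`.
      have hk' : k ∈ (List.range k).map Nat.succ := by
        simp only [List.mem_map, List.mem_range]
        exact ⟨k - 1, by omega, by omega⟩
      simp only [if_pos hk', add_zero]
      by_cases hj0 : j = 0
      · subst hj0
        simp [start, hg]
      · rw [if_pos]
        · simp [start, hj0]
        · simp only [List.mem_map, List.mem_range]
          exact ⟨j - 1, by omega, by omega⟩
    · obtain ⟨hr, c, n, hc, -⟩ := h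
      exact ⟨hr, c, n, hc⟩
    · obtain ⟨hr, c, n, hc, h⟩ := h
      refine ⟨hr, hgE, c, n, hc, fun j hj => ?_, fun j hj _ => by simpa using h j hj, by simp⟩
      dsimp only at hg
      rw [hj] at hg
      simp only [opGuard, Guard.sat_append, Guard.const_sat, Cmp.Holds, Nat.cast_zero] at hg
      have hjk : j < k := by have := hp g hgE; rwa [hj] at this
      have h := h j hjk
      -- Both the step clock and the tested clock are `0`, so `c j * r = 0`.
      simp only [hg.1, hg.2] at h
      simpa [hr.ne', eq_comm] using h
    · obtain ⟨hr, -, c, n, hc, hz, -, h⟩ := h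
      rw [hv.dur_sat] at hg
      obtain ⟨c', hc', hx⟩ := exists_step (s := s) hr (hp g hgE) hz (x := fun j => w (clk k j))
        fun j hj => by rw [← hg]; exact h j hj (Finset.mem_range.2 hj)
      refine ⟨hr, c', _, hc.tail hgE hc', fun j hj => ?_⟩
      simp [hj.ne, hx j hj]
    · obtain ⟨hr, -, c, n, hc, hz, h, h'⟩ := h
      rw [hv.thr_sat] at hg
      refine ⟨hr, hgE, c, n, hc, hz, fun i hi hiR => ?_, fun i hi hiR => ?_⟩
      · rw [Finset.mem_insert, not_or] at hiR
        simp [hiR.1, hj.ne', h i hi hiR.2]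
      · by_cases hij : i = j
        · subst hij
          simp only [List.mem_singleton, if_true, zero_add, hj.ne', if_false, ← hg]
          exact h i hi hjR
        · have hiR := (Finset.mem_insert.1 hiR).resolve_left hij
          simpa [hij, hj.ne'] using h' i hi hiR

end CounterPTA

/-! ### Completeness of the simulation: construction of runs. -/

namespace CounterPTA

open Function Encodable

theorem exists_run_edge {k : ℕ} {p : Prog} {v : ParamVal 6} {e : LEdge k} (he : e ∈ ledges k p)
    {w : ClockVal (k + 2)} {t : ℝ≥0} (h : (aut k p).Visits v (encode e.src) w t)
    (hg : e.guard.Sat v w) :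
    ∃ w', (aut k p).Run v (encode e.tgt) w' t ∧
      ∀ j < k + 2, w' (clk k j) = if j ∈ e.reset then 0 else w (clk k j) := by
  refine ⟨_, PTA.Visits.edge (inv_nil k p) (wellFormed k p)
    (e := ⟨encode e.src, e.guard, 0, e.reset.map (clk k), encode e.tgt⟩) h
    (List.mem_map_of_mem he) hg, fun j hj => ?_⟩
  exact ClockVal.reset_map (clk_inj k) (fun i hi => (reset_lt he i hi).trans (by omega)) hj w

theorem mem_ledges_of_mem_stepEdges {k : ℕ} {p : Prog} {g : GEdge} (hg : g ∈ p.graph [])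
    {e : LEdge k} (he : e ∈ stepEdges k g) : e ∈ ledges k p :=
  List.mem_append_right _ (List.mem_flatMap.2 ⟨g, hg, he⟩)

theorem resetEdge_mem {k : ℕ} (g : GEdge) {R : Finset ℕ} (hR : R ⊆ Finset.range k) {j : ℕ}
    (hj : j ∈ Finset.range k \ R) :
    ⟨.mid g R, Guard.between (clk k j) (thr g.2.1 j), [j], .mid g (insert j R)⟩ ∈
      stepEdges k g := by
  refine List.mem_append_right _ (List.mem_flatMap.2 ⟨R, ?_, List.mem_map.2 ⟨j, ?_, rfl⟩⟩)
  · simpa using hR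
  · rwa [Finset.mem_toList]

/-- In the simulation of an operation, all counters can be reset in time. -/
theorem exists_visits_resets {k : ℕ} {p : Prog} {v : ParamVal 6} {s r : ℝ≥0} {m : ℕ}
    (hv : Exact v s r m) {g : GEdge} (hg : g ∈ p.graph []) {c : ℕ → ℕ}
    (hdur : ∀ j < k, thrVal s r g.2.1 j ≤ c j * r + durVal s r g.2.1) (N : ℕ) :
    ∀ (R : Finset ℕ) (w : ClockVal (k + 2)) (t : ℝ≥0), R ⊆ Finset.range k →
      (Finset.range k \ R).card = N → (aut k p).Visits v (encode (Loc.mid g R)) w t →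
      (∀ j < k, j ∉ R → w (clk k j) = c j * r + w (clk k k) ∧
        c j * r + w (clk k k) ≤ thrVal s r g.2.1 j) →
      (∀ j < k, j ∈ R → w (clk k j) + thrVal s r g.2.1 j = c j * r + w (clk k k)) →
      w (clk k k) ≤ durVal s r g.2.1 →
      ∃ w' t', (aut k p).Visits v (encode (Loc.mid g (Finset.range k))) w' t' ∧
        w' (clk k k) = durVal s r g.2.1 ∧ t' + w (clk k k) = t + durVal s r g.2.1 ∧
        ∀ j < k, w' (clk k j) + thrVal s r g.2.1 j = c j * r + durVal s r g.2.1 := by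
  -- `N` counts the counter clocks still to be reset.
  induction N with
  | zero =>
    intro R w t hR hN h h1 h2 hle
    obtain rfl : R = Finset.range k :=
      hR.antisymm (Finset.sdiff_eq_empty_iff_subset.1 (Finset.card_eq_zero.1 hN))
    obtain ⟨d, hd⟩ := exists_add_of_le hle
    refine ⟨_, _, h.delay d, hd.symm, by rw [hd]; ring, fun j hj => ?_⟩
    have := h2 j hj (Finset.mem_range.2 hj)
    rw [hd, ← add_assoc, ← this]
    exact add_right_comm _ _ _
  | succ N ih =>
    intro R w t hR hN h h1 h2 hle
    -- The next clock to be reset is the one that reaches its threshold first. The truncated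
    -- subtraction is exact, since pending clocks satisfy `c j * r ≤ thrVal`.
    obtain ⟨j, hj, hmin⟩ := Finset.exists_min_image (Finset.range k \ R)
      (fun j => thrVal s r g.2.1 j - c j * r) (Finset.card_pos.1 (by omega))
    obtain ⟨hjk, hjR⟩ := Finset.mem_sdiff.1 hj
    rw [Finset.mem_range] at hjk
    obtain ⟨d, hd⟩ := exists_add_of_le (h1 j hjk hjR).2
    have hd' : thrVal s r g.2.1 j - c j * r = w (clk k k) + d := by
      rw [hd, add_assoc, add_tsub_cancel_left]
    obtain ⟨w', hrun, hw'⟩ := exists_run_edge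
      (mem_ledges_of_mem_stepEdges hg (resetEdge_mem g hR hj)) (h.delay d)
      ((hv.thr_sat _ _).2 (by rw [hd, ← (h1 j hjk hjR).1]; rfl))
    have hwk : w' (clk k k) = w (clk k k) + d := by
      rw [hw' k (by omega), if_neg (by simpa using hjk.ne')]; rfl
    obtain ⟨w₁, t₁, g1, g2, g3, g4⟩ := ih (insert j R) w' (t + d)
      (Finset.insert_subset (Finset.mem_range.2 hjk) hR)
      (by rw [Finset.sdiff_insert, Finset.card_erase_of_mem hj]; omega) hrun.visits
      (fun i hi hiR => by
        rw [Finset.mem_insert, not_or] at hiR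
        have e1 := h1 i hi hiR.2
        have e2 := hmin i (Finset.mem_sdiff.2 ⟨Finset.mem_range.2 hi, hiR.2⟩)
        simp only [hd'] at e2
        rw [hwk, hw' i (by omega), if_neg (by simpa using hiR.1)]
        refine ⟨by simp only [ClockVal.delay, e1.1, add_assoc], ?_⟩
        rw [le_tsub_iff_left (le_self_add.trans e1.2)] at e2
        exact e2)
      (fun i hi hiR => by
        rw [hwk, hw' i (by omega)]
        by_cases hij : i = j
        · subst hij
          simp [hd, add_assoc]
        · rw [if_neg (by simpa using hij), ← add_assoc,
            ← h2 i hi ((Finset.mem_insert.1 hiR).resolve_left hij)]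
          exact add_right_comm _ _ _)
      (by
        rw [hwk]
        have := hdur j hjk
        rw [hd, add_assoc] at this
        exact le_of_add_le_add_left this)
    refine ⟨w₁, t₁, g1, g2, ?_, g4⟩
    rw [hwk, add_right_comm t, ← add_assoc] at g3
    exact add_right_cancel g3

theorem step_unique {o : CounterOp} {c c₁ c₂ : ℕ → ℕ} (h₁ : o.Step c c₁) (h₂ : o.Step c c₂) :
    c₁ = c₂ := by
  cases o
  · exact h₁.trans h₂.symm
  · exact h₁.trans h₂.symm
  · exact h₁.2.trans h₂.2.symm
  · exact h₁.2.trans h₂.2.symm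

theorem durVal_le (s r : ℝ≥0) (o : CounterOp) : durVal s r o ≤ s + r := by
  cases o <;> simp [durVal]

/-- Together with `c j * r ≤ s`, this shows that no counter clock has passed its reset value when a
step starts. -/
theorem le_thrVal (s r : ℝ≥0) (o : CounterOp) (j : ℕ) : s ≤ thrVal s r o j := by
  cases o <;> simp only [thrVal] <;> (try split_ifs) <;> simp

/-- Every reset falls due before the step ends. For a decremented counter this needs a value of at
least `1`, which `Step` guarantees. -/
theorem thrVal_le {s r : ℝ≥0} {o : CounterOp} {c c' : ℕ → ℕ} (h : o.Step c c') (j : ℕ) :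
    thrVal s r o j ≤ c j * r + durVal s r o := by
  cases o with
  | nop | zero => simp [thrVal, durVal]
  | inc a =>
    simp only [thrVal, durVal]
    refine le_trans ?_ le_add_self
    split_ifs <;> simp
  | dec a =>
    simp only [thrVal, durVal]
    split_ifs with hj
    · subst hj
      rw [add_comm]
      have : (1 : ℝ≥0) ≤ c j := by exact_mod_cast Nat.one_le_iff_ne_zero.2 h.1
      gcongr
      exact le_mul_of_one_le_left zero_le this
    · exact le_add_self

/-- The simulation of an operation. -/
theorem exists_run_step {k : ℕ} {p : Prog} (hp : ∀ e ∈ p.graph [], regBound e.2.1 ≤ k)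
    {v : ParamVal 6} {s r : ℝ≥0} (hr : 0 < r) {m : ℕ}
    (hv : Exact v s r m) {g : GEdge} (hg : g ∈ p.graph []) {c c' : ℕ → ℕ}
    (hc : g.2.1.Step c c') (hcs : ∀ j, c j * r ≤ s) {w : ClockVal (k + 2)} {t : ℝ≥0}
    (h : (aut k p).Run v (encode (Loc.node g.1)) w t) (hwk : w (clk k k) = 0)
    (hw : ∀ j < k, w (clk k j) = c j * r) :
    ∃ w' t', (aut k p).Run v (encode (Loc.node g.2.2)) w' t' ∧ t' ≤ t + (s + r) ∧
      w' (clk k k) = 0 ∧ ∀ j < k, w' (clk k j) = c' j * r := by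
  have hz : ∀ j, g.2.1 = .zero j → c j = 0 := fun j hj => by
    rw [hj] at hc
    exact hc.1
  obtain ⟨w₁, h₁, hw₁⟩ := exists_run_edge (mem_ledges_of_mem_stepEdges hg
    (List.mem_append_left _ (List.mem_cons_self ..))) h.visits (by
      have := hp g hg
      dsimp only
      cases ho : g.2.1 with
      | zero a =>
        rw [ho] at this
        simp [opGuard, Guard.sat_append, Guard.const_sat, Cmp.Holds, hwk, hw a this, hz a ho]
      | _ => exact fun a ha => absurd ha (by simp [opGuard]))
  simp only [List.not_mem_nil, if_false] at hw₁
  have hk₁ : w₁ (clk k k) = 0 := by rw [hw₁ k (by omega), hwk]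
  obtain ⟨w₂, t₂, h₂, hk₂, ht₂, hw₂⟩ := exists_visits_resets hv hg
    (fun j _ => thrVal_le (s := s) (r := r) hc j) _ ∅ w₁ t (Finset.empty_subset _) rfl h₁.visits
    (fun j hj _ => by
      rw [hw₁ j (by omega), hk₁, add_zero, hw j hj]
      exact ⟨rfl, (hcs j).trans (le_thrVal s r _ j)⟩)
    (fun j _ hj => absurd hj (Finset.notMem_empty j)) (by simp [hk₁])
  obtain ⟨w₃, h₃, hw₃⟩ := exists_run_edge (mem_ledges_of_mem_stepEdges hg
    (List.mem_append_left _ (List.mem_cons_of_mem _ (List.mem_cons_self ..)))) h₂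
    ((hv.dur_sat _).2 hk₂)
  obtain ⟨c'', hc'', hx⟩ := exists_step hr (hp g hg) hz hw₂
  rw [step_unique hc hc'']
  rw [hk₁, add_zero] at ht₂
  refine ⟨w₃, t₂, h₃, ?_, ?_, fun j hj => ?_⟩
  · rw [ht₂]
    gcongr
    exact durVal_le s r _
  · rw [hw₃ k (by omega), if_pos (by simp)]
  · rw [hw₃ j (by omega), if_neg (by simpa using hj.ne), hx j hj]

/-- A step adds at most one to a counter. The bound tells how large `s` must be, compared with `r`,
for a path of length `n`. -/
theorem path_le {p : Prog} {m : ℕ} {a : List Prog} {c : ℕ → ℕ} {n : ℕ}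
    (h : Prog.Path (p.graph []) [p] (start m) a c n) (j : ℕ) : c j ≤ m + 1 + n := by
  induction h generalizing j with
  | refl =>
    simp only [start, update_apply]
    split_ifs <;> omega
  | @tail e c c' n _ _ hs ih =>
    have := ih j
    revert hs
    cases e.2.1 with
    | nop => rintro rfl; omega
    | zero => rintro ⟨-, rfl⟩; omega
    | inc a =>
      rintro rfl
      have := ih a
      simp only [update_apply]
      split_ifs <;> omega
    | dec a =>
      rintro ⟨-, rfl⟩
      have := ih a
      simp only [update_apply]
      split_ifs <;> omega

/-- The run waits for `s`, `r` and `(m + 1) * r` in the three initial locations. -/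
theorem exists_run_start {k : ℕ} (hk : 0 < k) {p : Prog} {v : ParamVal 6} {s r : ℝ≥0} (hr : 0 < r)
    {m : ℕ} (hv : Exact v s r m) :
    ∃ w t, (aut k p).Run v (encode (Loc.node [p])) w t ∧ t = s + r + (m + 1) * r ∧
      w (clk k k) = 0 ∧ ∀ j < k, w (clk k j) = start m j * r := by
  have h₀ := (PTA.run_init (inv_nil k p) (wellFormed k p) v).visits
  obtain ⟨w₁, h₁, hw₁⟩ := exists_run_edge (k := k) (p := p) (v := v)
    (List.mem_append_left _ (List.mem_cons_self ..)) (h₀.delay s) (by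
      rw [Guard.between_sat]
      simp [ClockVal.delay, sPar, hv.s_eq])
  simp only [ClockVal.delay, List.mem_singleton, zero_add] at hw₁ h₁
  obtain ⟨w₂, h₂, hw₂⟩ := exists_run_edge (k := k) (p := p) (v := v)
    (List.mem_append_left _ (List.mem_cons_of_mem _ (List.mem_cons_self ..))) (h₁.visits.delay r) (by
      rw [Guard.sat_append, Guard.between_sat, Guard.const_sat]
      simp [ClockVal.delay, qPar, hv.q_eq, hw₁ k (by omega), hw₁ 0 (by omega), hk.ne', Cmp.Holds,
        hr])
  have hz₂ : ∀ j ≤ k, w₂ (clk k j) = 0 := fun j hj => by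
    rw [hw₂ j (by omega), if_pos]
    simpa using Nat.lt_succ_of_le hj
  obtain ⟨w₃, h₃, hw₃⟩ := exists_run_edge (k := k) (p := p) (v := v)
    (List.mem_append_left _ (List.mem_cons_of_mem _ (List.mem_cons_of_mem _
      (List.mem_cons_self ..)))) (h₂.visits.delay ((m + 1) * r)) (by
      rw [Guard.between_sat]
      simp [ClockVal.delay, iPar, hv.i_eq, hz₂ 0 (by omega)])
  refine ⟨w₃, _, h₃, rfl, ?_, fun j hj => ?_⟩
  · rw [hw₃ k (by omega), if_pos]
    simp only [List.mem_map, List.mem_range]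
    exact ⟨k - 1, by omega, by omega⟩
  · rw [hw₃ j (by omega)]
    by_cases hj0 : j = 0
    · subst hj0
      simp [start, ClockVal.delay, hz₂ 0 (by omega)]
    · rw [if_pos]
      · simp [start, hj0]
      · simp only [List.mem_map, List.mem_range]
        exact ⟨j - 1, by omega, by omega⟩

/-- The simulation of a path of the graph. -/
theorem exists_run_path {k : ℕ} (hk : 0 < k) {p : Prog}
    (hp : ∀ e ∈ p.graph [], regBound e.2.1 ≤ k) {v : ParamVal 6} {s r : ℝ≥0} (hr : 0 < r) {m : ℕ}
    (hv : Exact v s r m) {a : List Prog} {c : ℕ → ℕ} {n : ℕ}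
    (h : Prog.Path (p.graph []) [p] (start m) a c n) (hs : (m + 1 + n) * r ≤ s) :
    ∃ w t, (aut k p).Run v (encode (Loc.node a)) w t ∧
      t ≤ s + r + (m + 1) * r + n * (s + r) ∧ w (clk k k) = 0 ∧
      ∀ j < k, w (clk k j) = c j * r := by
  induction h with
  | refl =>
    obtain ⟨w, t, h1, rfl, h2⟩ := exists_run_start (p := p) hk hr hv
    exact ⟨w, _, h1, by simp, h2⟩
  | @tail e c c' n hpath he hc ih =>
    have hs' : (m + 1 + n) * r ≤ s := by
      refine le_trans ?_ hs
      gcongr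
      simp
    obtain ⟨w, t, h1, h2, h3, h4⟩ := ih hs'
    obtain ⟨w', t', g1, g2, g3⟩ := exists_run_step hp hr hv he hc (fun j => by
      refine le_trans ?_ hs'
      gcongr
      exact_mod_cast path_le hpath j) h1 h3 h4
    refine ⟨w', t', g1, g2.trans ?_, g3⟩
    calc t + (s + r) ≤ s + r + (m + 1) * r + n * (s + r) + (s + r) := by gcongr
      _ = _ := by push_cast; ring

/-- The simulation finishes by time `1`, and the rest of the time is spent waiting in the final
node. -/
theorem goal_reached {k : ℕ} (hk : 0 < k) {p : Prog}
    (hp : ∀ e ∈ p.graph [], regBound e.2.1 ≤ k) {v : ParamVal 6} {s r : ℝ≥0} (hr : 0 < r) {m : ℕ}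
    (hv : Exact v s r m) {c : ℕ → ℕ} {n : ℕ}
    (h : Prog.Path (p.graph []) [p] (start m) [] c n) (hs : (m + 1 + n) * r ≤ s)
    (hq : (n + 2) * (s + r) ≤ 1) : ((aut k p).reachDurations v goal).Nonempty := by
  obtain ⟨w, t, h1, h2, -⟩ := exists_run_path hk hp hr hv h hs
  -- So the initial phase costs at most `2 * (s + r)`, and each of the `n` steps at most `s + r`.
  have hm : (m + 1) * r ≤ s + r := by
    refine (le_trans ?_ hs).trans le_self_add
    gcongr ?_ * r
    exact le_self_add
  obtain ⟨d, hd⟩ : ∃ d, 1 = t + d := by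
    refine exists_add_of_le (h2.trans (le_trans ?_ hq))
    calc s + r + (m + 1) * r + n * (s + r) ≤ s + r + (s + r) + n * (s + r) :=
          add_le_add (add_le_add le_rfl hm) le_rfl
      _ = (n + 2) * (s + r) := by ring
  obtain ⟨L, -, hL, -⟩ := bounds_of_run hk h1
  obtain ⟨w', h', -⟩ := exists_run_edge (k := k) (p := p) (v := v)
    (List.mem_append_left _ (List.mem_cons_of_mem _ (List.mem_cons_of_mem _ (List.mem_cons_of_mem _
      (List.mem_cons_self ..))))) (h1.visits.delay d) (by
      rw [Guard.const_sat]
      simp [ClockVal.delay, Cmp.Holds, hL, hd])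
  exact ⟨_, _, List.mem_singleton_self _, w', h'⟩

/-- The goal is only reached at time `1`. -/
theorem eq_one_of_mem_reachDurations {k : ℕ} (hk : 0 < k) {p : Prog} {v : ParamVal 6} {t : ℝ≥0}
    (ht : t ∈ (aut k p).reachDurations v goal) : t = 1 := by
  obtain ⟨l, hl, w, h⟩ := ht
  obtain rfl := List.mem_singleton.1 hl
  rcases h.last with h | ⟨e, he, htgt, w₀, ⟨w₁, t₁, d, h, rfl, rfl⟩, hg⟩
  · exact absurd (encode_injective h) (by simp)
  · obtain ⟨e, hmem, rfl⟩ := List.mem_map.1 he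
    obtain ⟨L, -, hL, -⟩ := bounds_of_run hk h
    have htgt := encode_injective htgt
    rcases mem_ledges hmem with rfl | rfl | rfl | rfl | ⟨g, -, rfl | rfl | ⟨R, j, -, -, rfl⟩⟩
    · exact absurd htgt (by simp)
    · exact absurd htgt (by simp)
    · exact absurd htgt (by simp)
    · rw [Guard.const_sat] at hg
      simpa [ClockVal.delay, Cmp.Holds, hL] using hg
    all_goals exact absurd htgt (by simp)

end CounterPTA

/-! The automaton that compares the parameter `i` with `(m + 1) * (q - s)`, with lower-bound and
upper-bound parameters interchanged. -/

namespace ChainPTA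

/-- The automaton, with a clock that represents a counter, a clock that measures the duration of a
step and a clock that measures the total time. -/
def aut (m : ℕ) : PTA 3 6 where
  numAct := 1
  init := 0
  inv := List.replicate (2 * m + 5) []
  edges := ((List.range (m + 1)).flatMap fun j =>
      [⟨2 * j, Guard.between 0 (1, 0), 0, [0], 2 * j + 1⟩,
        ⟨2 * j + 1, Guard.between 1 (3, 2), 0, [1], 2 * j + 2⟩]) ++
    [⟨2 * m + 2, Guard.const 1 .eq 0 ++ Guard.between 0 (5, 4), 0, [], 2 * m + 3⟩,
      ⟨2 * m + 3, Guard.const 2 .eq 1, 0, [], 2 * m + 4⟩]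

/-- The target. -/
def goal (m : ℕ) : List ℕ := [2 * m + 4]

theorem mem_edges {m : ℕ} {e : Edge 3 6} : e ∈ (aut m).edges ↔
    (∃ j ≤ m, e = ⟨2 * j, Guard.between 0 (1, 0), 0, [0], 2 * j + 1⟩) ∨
    (∃ j ≤ m, e = ⟨2 * j + 1, Guard.between 1 (3, 2), 0, [1], 2 * j + 2⟩) ∨
    e = ⟨2 * m + 2, Guard.const 1 .eq 0 ++ Guard.between 0 (5, 4), 0, [], 2 * m + 3⟩ ∨
    e = ⟨2 * m + 3, Guard.const 2 .eq 1, 0, [], 2 * m + 4⟩ := by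
  simp only [aut, List.mem_append, List.mem_flatMap, List.mem_range, List.mem_cons,
    List.not_mem_nil, or_false, Nat.lt_succ_iff, and_or_left, exists_or, or_assoc]

theorem wellFormed (m : ℕ) : (aut m).WellFormed where
  init_lt := by simp [aut, PTA.numLoc]
  edges_lt e he := by
    have : (aut m).numLoc = 2 * m + 5 := by simp [aut, PTA.numLoc]
    rw [this]
    rcases mem_edges.1 he with ⟨j, hj, rfl⟩ | ⟨j, hj, rfl⟩ | rfl | rfl <;>
      refine ⟨?_, Nat.zero_lt_one, ?_⟩ <;> dsimp only <;> omega

theorem inv_nil (m : ℕ) : ∀ g ∈ (aut m).inv, g = [] := fun _ hg => List.eq_of_mem_replicate hg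

theorem isLUInstance (m : ℕ) : (aut m).IsLUInstance (goal m) where
  wellFormed := wellFormed m
  isLU := by
    refine ⟨{1, 3, 5}, fun g hg => ?_⟩
    change Guard.LU {1, 3, 5} g
    rcases List.mem_append.1 hg with hg | hg
    · obtain rfl := List.eq_of_mem_replicate hg
      exact Guard.lu_nil _
    · obtain ⟨e, he, rfl⟩ := List.mem_map.1 hg
      rcases mem_edges.1 he with ⟨j, -, rfl⟩ | ⟨j, -, rfl⟩ | rfl | rfl
      · exact Guard.lu_between _ (by simp) (by simp)
      · exact Guard.lu_between _ (by simp) (by simp)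
      · exact (Guard.lu_const _ _ _ _).append (Guard.lu_between _ (by simp) (by simp))
      · exact Guard.lu_const _ _ _ _
  target_lt l hl := by
    obtain rfl := List.mem_singleton.1 hl
    simp [aut, PTA.numLoc]

/-- Location numbers increase along the chain, so they tell which guards have been passed. As there
are `m + 1 ≥ 1` rounds, every pair of parameters is tested. -/
theorem bounds_of_run {m : ℕ} {v : ParamVal 6} {l : ℕ} {w : ClockVal 3} {t : ℝ≥0}
    (h : (aut m).Run v l w t) : w 2 = t ∧ (1 ≤ l → v 1 ≤ v 0) ∧ (2 ≤ l → v 3 ≤ v 2) ∧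
      (2 * m + 3 ≤ l → v 5 ≤ v 4) := by
  refine PTA.Run.invariant_induction (P := fun l w t => w 2 = t ∧ (1 ≤ l → v 1 ≤ v 0) ∧
    (2 ≤ l → v 3 ≤ v 2) ∧ (2 * m + 3 ≤ l → v 5 ≤ v 4)) ?_ ?_ ?_ h
  · simp [aut]
  · rintro l w _ d ⟨rfl, h⟩
    exact ⟨rfl, h⟩
  · intro e he w t ⟨h0, h1, h2, h3⟩ hg
    have cast {a b : Fin 6} {x : ℝ≥0} (h : ((v a : ℚ≥0) : ℝ≥0) ≤ x ∧ x ≤ ((v b : ℚ≥0) : ℝ≥0)) :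
        v a ≤ v b := by exact_mod_cast h.1.trans h.2
    rcases mem_edges.1 he with ⟨j, hj, rfl⟩ | ⟨j, hj, rfl⟩ | rfl | rfl
    · have := cast (Guard.between_sat.1 hg)
      exact ⟨by simpa [ClockVal.reset] using h0, fun _ => this,
        fun h => h2 (by dsimp only at h ⊢; omega), fun h => h3 (by dsimp only at h ⊢; omega)⟩
    · have := cast (Guard.between_sat.1 hg)
      exact ⟨by simpa [ClockVal.reset] using h0, fun h => h1 (by dsimp only; omega),
        fun _ => this, fun h => h3 (by dsimp only at h ⊢; omega)⟩
    · have := cast (Guard.between_sat.1 (Guard.sat_append.1 hg).2)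
      exact ⟨by simpa [ClockVal.reset] using h0, fun h => h1 (by dsimp only; omega),
        fun h => h2 (by dsimp only; omega), fun _ => this⟩
    · exact ⟨by simpa [ClockVal.reset] using h0, fun h => h1 (by dsimp only; omega),
        fun h => h2 (by dsimp only; omega), fun h => h3 (by dsimp only; omega)⟩

/-- The goal is only reached at time `1`. -/
theorem eq_one_of_mem_reachDurations {m : ℕ} {v : ParamVal 6} {t : ℝ≥0}
    (ht : t ∈ (aut m).reachDurations v (goal m)) : t = 1 := by
  obtain ⟨l, hl, w, h⟩ := ht
  obtain rfl := List.mem_singleton.1 hl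
  rcases h.last with h | ⟨e, he, htgt, w₀, ⟨w₁, t₁, d, h', rfl, rfl⟩, hg⟩
  · simp [aut] at h
  · obtain ⟨hL, -⟩ := bounds_of_run h'
    rcases mem_edges.1 he with ⟨j, hj, rfl⟩ | ⟨j, hj, rfl⟩ | rfl | rfl
    · dsimp only at htgt; omega
    · dsimp only at htgt; omega
    · dsimp only at htgt; omega
    · rw [Guard.const_sat] at hg
      have hg : w₁ 2 + d = ((1 : ℕ) : ℝ≥0) := hg
      rw [← hL, hg, Nat.cast_one]

theorem bounds_of_goal_reached {m : ℕ} {v : ParamVal 6}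
    (h : ((aut m).reachDurations v (goal m)).Nonempty) : v 1 ≤ v 0 ∧ v 3 ≤ v 2 ∧ v 5 ≤ v 4 := by
  obtain ⟨t, l, hl, w, h⟩ := h
  obtain rfl := List.mem_singleton.1 hl
  obtain ⟨-, h1, h2, h3⟩ := bounds_of_run h
  exact ⟨h1 (by omega), h2 (by omega), h3 (by omega)⟩

/-- A round resets clock `0` at `s` and clock `1` at `s + r`, which raises the difference of the two
clocks by `r`. After `m + 1` rounds, when clock `1` is `0`, clock `0` shows `(m + 1) * r` and is
compared with `i`. -/
theorem eq_of_goal_reached {m : ℕ} {v : ParamVal 6} {s r i : ℝ≥0}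
    (hs : ((v 0 : ℚ≥0) : ℝ≥0) = s ∧ ((v 1 : ℚ≥0) : ℝ≥0) = s)
    (hq : ((v 2 : ℚ≥0) : ℝ≥0) = s + r ∧ ((v 3 : ℚ≥0) : ℝ≥0) = s + r)
    (hi : ((v 4 : ℚ≥0) : ℝ≥0) = i ∧ ((v 5 : ℚ≥0) : ℝ≥0) = i)
    (h : ((aut m).reachDurations v (goal m)).Nonempty) : i = (m + 1) * r := by
  obtain ⟨t, l, hl, w, h⟩ := h
  obtain rfl := List.mem_singleton.1 hl
  have key := PTA.Run.invariant_induction (P := fun l w t =>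
    (∀ j, l = 2 * j → j ≤ m + 1 → w 0 = j * r + w 1) ∧
    (∀ j, l = 2 * j + 1 → j ≤ m → w 0 + s = j * r + w 1) ∧
    (2 * m + 3 ≤ l → i = (m + 1) * r)) ?_ ?_ ?_ h
  · exact key.2.2 (by omega)
  · refine ⟨fun j hj _ => ?_, fun j hj => ?_, fun h => ?_⟩
    · obtain rfl : j = 0 := by simp only [aut] at hj; omega
      simp
    · simp only [aut] at hj; omega
    · simp only [aut] at h; omega
  · intro l w t d ⟨h1, h2, h3⟩
    refine ⟨fun j hl hj => ?_, fun j hl hj => ?_, h3⟩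
    · simp only [ClockVal.delay, h1 j hl hj, add_assoc]
    · change w 0 + d + s = j * r + (w 1 + d)
      rw [add_right_comm, h2 j hl hj, add_assoc]
  · intro e he w t ⟨h1, h2, h3⟩ hg
    rcases mem_edges.1 he with ⟨j, hj, rfl⟩ | ⟨j, hj, rfl⟩ | rfl | rfl
    · rw [Guard.between_sat, hs.1, hs.2] at hg
      refine ⟨fun j' h _ => ?_, fun j' h _ => ?_, fun h => ?_⟩
      · dsimp only at h; omega
      · obtain rfl : j = j' := by dsimp only at h; omega
        have := h1 j rfl (by omega)
        rw [le_antisymm hg.2 hg.1] at this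
        simpa [ClockVal.reset] using this
      · dsimp only at h; omega
    · rw [Guard.between_sat, hq.1, hq.2] at hg
      refine ⟨fun j' h _ => ?_, fun j' h _ => ?_, fun h => ?_⟩
      · obtain rfl : j + 1 = j' := by dsimp only at h; omega
        have := h2 j rfl hj
        rw [le_antisymm hg.2 hg.1, add_left_comm, add_comm] at this
        have := add_left_cancel this
        simp [ClockVal.reset, this, add_mul]
      · dsimp only at h; omega
      · dsimp only at h; omega
    · rw [Guard.sat_append, Guard.between_sat, Guard.const_sat, hi.1, hi.2] at hg
      refine ⟨fun j' h _ => ?_, fun j' h _ => ?_, fun _ => ?_⟩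
      · dsimp only at h; omega
      · dsimp only at h; omega
      · have := h1 (m + 1) (by dsimp only; omega) le_rfl
        have hz : w 1 = 0 := by simpa [Cmp.Holds] using hg.1
        rw [le_antisymm hg.2.2 hg.2.1, hz] at this
        simpa using this
    · refine ⟨fun j' h _ => ?_, fun j' h _ => ?_, fun _ => h3 (by dsimp only; omega)⟩
      · dsimp only at h; omega
      · dsimp only at h; omega

/-- Round `j ≤ m` starts with clock `0` at `j * r ≤ s`. It waits for `s - j * r` and then for `(j +
1) * r`, in total `s + r`. -/
theorem goal_reached {m : ℕ} {v : ParamVal 6} {s r : ℝ≥0} (hv : CounterPTA.Exact v s r m)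
    (hr : m * r ≤ s) (hq : (m + 1) * (s + r) ≤ 1) :
    ((aut m).reachDurations v (goal m)).Nonempty := by
  have key : ∀ j ≤ m + 1, ∃ w, (aut m).Run v (2 * j) w (j * (s + r)) ∧ w 0 = j * r ∧ w 1 = 0 := by
    intro j
    induction j with
    | zero => exact fun _ => ⟨_, by simpa using! PTA.run_init (inv_nil m) (wellFormed m) v, by simp⟩
    | succ j ih =>
      intro hj
      obtain ⟨w, h, hw0, hw1⟩ := ih (by omega)
      obtain ⟨d, hd⟩ : ∃ d, s = j * r + d := by
        refine exists_add_of_le (le_trans ?_ hr)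
        have : (j : ℝ≥0) ≤ m := by exact_mod_cast Nat.le_of_succ_le_succ hj
        gcongr
      have h1 := PTA.Visits.edge (inv_nil m) (wellFormed m) (h.visits.delay d)
        (mem_edges.2 (.inl ⟨j, by omega, rfl⟩))
        (by rw [Guard.between_sat, hv.s_eq.1, hv.s_eq.2]; simp [ClockVal.delay, hw0, hd])
      have h2 := PTA.Visits.edge (inv_nil m) (wellFormed m) (h1.visits.delay ((j + 1) * r))
        (mem_edges.2 (.inr (.inl ⟨j, by omega, rfl⟩)))
        (by
          have : d + (j + 1) * r = s + r := by rw [hd]; ring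
          rw [Guard.between_sat, hv.q_eq.1, hv.q_eq.2]
          simp [ClockVal.delay, ClockVal.reset, hw1, this])
      have ht : (j : ℝ≥0) * (s + r) + d + (j + 1) * r = ((j + 1 : ℕ) : ℝ≥0) * (s + r) := by
        rw [hd]; push_cast; ring
      rw [ht] at h2
      exact ⟨_, h2, by simp [ClockVal.delay, ClockVal.reset], by simp [ClockVal.reset]⟩
  obtain ⟨w, h, hw0, hw1⟩ := key (m + 1) le_rfl
  have h1 := PTA.Visits.edge (inv_nil m) (wellFormed m) h.visits
    (mem_edges.2 (.inr (.inr (.inl rfl)))) (by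
      rw [Guard.sat_append, Guard.between_sat, Guard.const_sat, hv.i_eq.1, hv.i_eq.2]
      simp [Cmp.Holds, hw0, hw1])
  obtain ⟨d, hd⟩ := exists_add_of_le hq
  have ht := (bounds_of_run h1).1
  have h2 := PTA.Visits.edge (inv_nil m) (wellFormed m) (h1.visits.delay d)
    (mem_edges.2 (.inr (.inr (.inr rfl)))) (by
      rw [Guard.const_sat]
      change w.reset [] 2 + d = ((1 : ℕ) : ℝ≥0)
      rw [ht, Nat.cast_one, hd]
      push_cast
      rfl)
  exact ⟨_, _, List.mem_singleton_self _, _, h2⟩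

end ChainPTA

/-! An undecidable set of numbers. -/

open Nat.Partrec (Code) in
/-- A function with `∃ t, haltTest m t = 0` if and only if `m = 3 a` and the program with number `a`
halts, or `m = 3 a + 1`. -/
def haltTest (m t : ℕ) : ℕ :=
  if m % 3 = 0 then
    bif (Code.evaln t (Denumerable.ofNat Code (m / 3)) 0).isSome then 0 else 1
  else m % 3 - 1

open Nat.Partrec (Code) in
theorem primrec_haltTest : Primrec₂ haltTest := by
  have hmod : Primrec fun x : ℕ × ℕ => x.1 % 3 := Primrec.nat_mod.comp .fst (.const 3)
  have hcode : Primrec fun x : ℕ × ℕ => Denumerable.ofNat Code (x.1 / 3) :=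
    (Primrec.ofNat Code).comp (Primrec.nat_div.comp .fst (.const 3))
  exact Primrec.ite (Primrec.eq.comp hmod (.const 0))
    (Primrec.cond (Primrec.option_isSome.comp
      (Code.primrec_evaln.comp ((Primrec.snd.pair hcode).pair (.const 0)))) (.const 0) (.const 1))
    (Primrec.nat_sub.comp hmod (.const 1))

/-- The residues `1` and `2` play no part in undecidability; they serve the argument against finite
unions of polyhedra. -/
theorem exists_haltTest_one (a : ℕ) : ∃ t, haltTest (3 * a + 1) t = 0 :=
  ⟨0, by
    have : (3 * a + 1) % 3 = 1 := by omega
    simp [haltTest, this]⟩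

theorem not_exists_haltTest_two (a : ℕ) : ¬ ∃ t, haltTest (3 * a + 2) t = 0 := by
  rintro ⟨t, ht⟩
  have : (3 * a + 2) % 3 = 2 := by omega
  simp [haltTest, this] at ht

open Nat.Partrec (Code) in
theorem exists_haltTest_zero (c : Code) :
    (∃ t, haltTest (3 * Encodable.encode c) t = 0) ↔ (c.eval 0).Dom := by
  have h1 : 3 * Encodable.encode c % 3 = 0 := by omega
  have h2 : 3 * Encodable.encode c / 3 = Encodable.encode c := by omega
  simp only [haltTest, h1, h2, if_true, Denumerable.ofNat_encode, Part.dom_iff_mem,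
    Code.evaln_complete]
  constructor
  · rintro ⟨t, ht⟩
    cases h : Code.evaln t c 0 with
    | none => simp [h] at ht
    | some y => exact ⟨y, t, by simp [h]⟩
  · rintro ⟨y, t, h⟩
    rw [Option.mem_def] at h
    exact ⟨t, by simp [h]⟩

/-- Reduction of the halting problem to a predicate. -/
theorem not_computablePred_of_haltTest {β : Type} [Primcodable β] {P : β → Prop} {c : ℕ → β}
    (hc : Computable c) (h : ∀ m, P (c m) ↔ ¬ ∃ t, haltTest m t = 0) : ¬ ComputablePred P := by
  intro hP
  refine ComputablePred.halting_problem 0 (ComputablePred.computable_of_manyOneReducible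
    (q := fun b => ¬ P b) ⟨fun d => c (3 * Encodable.encode d), ?_, fun d => ?_⟩ hP.not)
  · exact hc.comp (Primrec.nat_mul.comp (.const 3) .encode).to_comp
  · change (d.eval 0).Dom ↔ ¬ P (c _)
    rw [h, not_not, exists_haltTest_zero]

/-! Computability of the automata and polyhedra that encode an input. -/

theorem Primrec.list_replicate {α β : Type} [Primcodable α] [Primcodable β] {f : α → ℕ}
    (hf : Primrec f) (b : β) : Primrec fun a => List.replicate (f a) b :=
  (Primrec.list_map (Primrec.list_range.comp hf) (Primrec₂.const b)).of_eq fun a => by simp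

theorem Edge.primrec_mk {α : Type} [Primcodable α] {k n : ℕ} {f g : α → ℕ} (hf : Primrec f)
    (hg : Primrec g) (G : Guard k n) (R : List (Fin k)) :
    Primrec fun a => (⟨f a, G, 0, R, g a⟩ : Edge k n) :=
  (Primrec.of_equiv_symm (e := Edge.equivProd k n)).comp
    (hf.pair ((Primrec.const G).pair ((Primrec.const 0).pair ((Primrec.const R).pair hg))))

theorem ChainPTA.primrec_aut : Primrec ChainPTA.aut := by
  have lin (a b : ℕ) : Primrec fun m : ℕ => a * m + b :=
    Primrec.nat_add.comp (Primrec.nat_mul.comp (.const a) .id) (.const b)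
  have lin' (a b : ℕ) : Primrec fun x : ℕ × ℕ => a * x.2 + b := (lin a b).comp .snd
  have hedges : Primrec fun m => (ChainPTA.aut m).edges := by
    refine Primrec.list_append.comp (Primrec.list_flatMap
      (Primrec.list_range.comp (Primrec.nat_add.comp .id (.const 1))) ?_) ?_
    · exact Primrec.list_cons.comp (Edge.primrec_mk (lin' 2 0) (lin' 2 1) _ _)
        (Primrec.list_cons.comp (Edge.primrec_mk (lin' 2 1) (lin' 2 2) _ _) (.const []))
    · exact Primrec.list_cons.comp (Edge.primrec_mk (lin 2 2) (lin 2 3) _ _)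
        (Primrec.list_cons.comp (Edge.primrec_mk (lin 2 3) (lin 2 4) _ _) (.const []))
  exact (Primrec.of_equiv_symm (e := PTA.equivProd 3 6)).comp ((Primrec.const 1).pair
    ((Primrec.const 0).pair ((Primrec.list_replicate (lin 2 5) _).pair hedges)))

theorem ChainPTA.primrec_goal : Primrec ChainPTA.goal :=
  Primrec.list_cons.comp (Primrec.nat_add.comp (Primrec.nat_mul.comp (.const 2) .id) (.const 4))
    (.const [])

/-- The polyhedron of the valuations with equal bounds for each parameter and
`i = (m + 1) * (q - s)`. -/
def inputPolyhedron (m : ℕ) : Polyhedron 6 :=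
  [(![1, -1, 0, 0, 0, 0], 0, .eq), (![0, 0, 1, -1, 0, 0], 0, .eq), (![0, 0, 0, 0, 1, -1], 0, .eq),
    (![((m + 1 : ℕ) : ℤ), 0, Int.negSucc m, 0, 1, 0], 0, .eq)]

theorem primrec_inputPolyhedron : Primrec inputPolyhedron := by
  -- The encoding of integers sends `n` to `2 * n` and `Int.negSucc n` to `2 * n + 1`.
  have h1 : Primrec fun m : ℕ => ((m + 1 : ℕ) : ℤ) :=
    Primrec.encode_iff.1 (Primrec.nat_mul.comp (.const 2) Primrec.succ)
  have h2 : Primrec fun m : ℕ => Int.negSucc m :=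
    Primrec.encode_iff.1 (Primrec.nat_add.comp (Primrec.nat_mul.comp (.const 2) .id) (.const 1))
  have h3 : Primrec fun m : ℕ => ![((m + 1 : ℕ) : ℤ), 0, Int.negSucc m, 0, 1, 0] := by
    refine Primrec.fin_curry.2 (Primrec₂.swap (Primrec.fin_curry₁.2 fun j => ?_))
    fin_cases j
    exacts [h1, .const 0, h2, .const 0, .const 1, .const 0]
  exact Primrec.list_cons.comp (.const _) (Primrec.list_cons.comp (.const _)
    (Primrec.list_cons.comp (.const _) (Primrec.list_cons.comp (h3.pair (.const _)) (.const []))))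

/-- Polyhedra are convex. -/
theorem Polyhedron.convexCombination_mem {n : ℕ} {P : Polyhedron n} {v w : ParamVal n}
    (hv : v ∈ P.toSet) (hw : w ∈ P.toSet) {a b : ℚ≥0} (hab : a + b = 1) :
    (fun j => a * v j + b * w j) ∈ P.toSet := by
  intro c hc
  have hconv : Convex ℚ {x : ℚ | c.2.2.Holds x 0} := by
    cases c.2.2
    exacts [convex_Iio 0, convex_Iic 0, convex_singleton 0, convex_Ici 0, convex_Ioi 0]
  have h := hconv (hv c hc) (hw c hc) (a := (a : ℚ)) (b := (b : ℚ)) a.2 b.2 (by exact_mod_cast hab)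
  have key : (∑ j, (c.1 j : ℚ) * ((a * v j + b * w j : ℚ≥0) : ℚ) + (c.2.1 : ℚ)) =
      (a : ℚ) • (∑ j, (c.1 j : ℚ) * (v j : ℚ) + (c.2.1 : ℚ)) +
        (b : ℚ) • (∑ j, (c.1 j : ℚ) * (w j : ℚ) + (c.2.1 : ℚ)) := by
    have hab' : (a : ℚ) + b = 1 := by exact_mod_cast hab
    simp only [smul_eq_mul, mul_add, Finset.mul_sum]
    rw [add_add_add_comm, ← Finset.sum_add_distrib, ← add_mul, hab', one_mul]
    congr 1
    refine Finset.sum_congr rfl fun j _ => ?_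
    push_cast
    ring
  change c.2.2.Holds _ _
  rw [key]
  exact h

/-! ### Valuations that encode an input. -/

namespace CounterPTA

/-- The valuation with parameter values `s`, `q = s + r` and `i = (m + 1) * r`. -/
def inputVal (s r : ℚ≥0) (m : ℕ) : ParamVal 6 :=
  ![s, s, s + r, s + r, (m + 1) * r, (m + 1) * r]

theorem exact_inputVal (s r : ℚ≥0) (m : ℕ) : Exact (inputVal s r m) (s : ℝ≥0) (r : ℝ≥0) m := by
  constructor <;> simp [inputVal]

theorem eq_inputVal {v : ParamVal 6} {m : ℕ} (h0 : v 1 = v 0) (h2 : v 3 = v 2) (h4 : v 5 = v 4)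
    {r : ℚ≥0} (hr : v 2 = v 0 + r) (hi : v 4 = (m + 1) * r) : v = inputVal (v 0) r m := by
  ext j
  fin_cases j <;> simp [inputVal, h0, h2, h4, hr, hi]

theorem mem_inputPolyhedron {v : ParamVal 6} {m : ℕ} :
    v ∈ (inputPolyhedron m).toSet ↔ ∃ s r, v = inputVal s r m := by
  have hv : v ∈ (inputPolyhedron m).toSet ↔
      v 1 = v 0 ∧ v 3 = v 2 ∧ v 5 = v 4 ∧ v 4 + (m + 1) * v 0 = (m + 1) * v 2 := by
    have hcast : ∀ a b : ℚ≥0, a = b ↔ (a : ℚ) = b := fun a b => NNRat.coe_inj.symm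
    simp only [Polyhedron.toSet, inputPolyhedron, Set.mem_ofPred_eq, List.mem_cons,
      List.not_mem_nil, or_false, forall_eq_or_imp, forall_eq, Fin.sum_univ_six, Cmp.Holds, hcast]
    simp only [Matrix.cons_val, Int.negSucc_eq]
    push_cast
    constructor
    · rintro ⟨h1, h2, h3, h4⟩
      refine ⟨?_, ?_, ?_, ?_⟩ <;> linarith
    · rintro ⟨h1, h2, h3, h4⟩
      refine ⟨?_, ?_, ?_, ?_⟩ <;> linarith
  rw [hv]
  constructor
  · rintro ⟨h0, h2, h4, h⟩
    have hm : (0 : ℚ≥0) < m + 1 := by positivity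
    obtain ⟨r, hr⟩ : ∃ r, v 2 = v 0 + r :=
      exists_add_of_le (le_of_mul_le_mul_left (h ▸ le_add_self) hm)
    rw [hr, mul_add, add_comm] at h
    exact ⟨v 0, r, eq_inputVal h0 h2 h4 hr (add_left_cancel h)⟩
  · rintro ⟨s, r, rfl⟩
    simp only [inputVal]
    simp
    ring

variable {k : ℕ} {p : Prog}

theorem bounds_of_goal_reached (hk : 0 < k) {v : ParamVal 6}
    (h : ((aut k p).reachDurations v goal).Nonempty) :
    v 0 ≤ v 1 ∧ v 2 ≤ v 3 ∧ v 0 ≤ v 3 ∧ v 4 ≤ v 5 := by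
  obtain ⟨t, l, hl, w, h⟩ := h
  obtain rfl := List.mem_singleton.1 hl
  obtain ⟨L, hL, -, -, h⟩ := bounds_of_run hk h
  obtain rfl := Encodable.encode_injective hL
  simpa using h

theorem exists_path_of_goal_reached (hk : 0 < k) (hp : ∀ e ∈ p.graph [], regBound e.2.1 ≤ k)
    {v : ParamVal 6} {s r : ℝ≥0} {m : ℕ} (hv : Exact v s r m)
    (h : ((aut k p).reachDurations v goal).Nonempty) :
    0 < r ∧ ∃ c n, Prog.Path (p.graph []) [p] (start m) [] c n := by
  obtain ⟨t, l, hl, w, h⟩ := h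
  obtain rfl := List.mem_singleton.1 hl
  obtain ⟨L, hL, h⟩ := simInv_of_run hk hp hv h
  obtain rfl := Encodable.encode_injective hL
  exact h

/-- For small parameter values, a path can be simulated within one time unit. -/
theorem exists_inputVal (hk : 0 < k) (hp : ∀ e ∈ p.graph [], regBound e.2.1 ≤ k) {m : ℕ}
    {c : ℕ → ℕ} {n : ℕ} (h : Prog.Path (p.graph []) [p] (start m) [] c n) :
    ∃ s r, 0 < r ∧ ((aut k p).reachDurations (inputVal s r m) goal).Nonempty ∧
      ((ChainPTA.aut m).reachDurations (inputVal s r m) (ChainPTA.goal m)).Nonempty := by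
  -- `C` bounds the counters along the path, so `s = C * r` is large enough. The choice of `r` makes
  -- `(C + 1) * (s + r) = 1`, and `C + 1` is at least both `n + 2` and `m + 1`.
  set C : ℚ≥0 := m + 1 + n with hC
  set r : ℚ≥0 := ((C + 1) * (C + 1))⁻¹ with hr
  have hr0 : 0 < r := by positivity
  have hq : (C + 1) * (C * r + r) = 1 := by
    rw [hr]
    field_simp
  have hq' : ((C : ℝ≥0) + 1) * (C * r + r) = 1 := by exact_mod_cast hq
  have hC' : (C : ℝ≥0) = m + 1 + n := by rw [hC]; push_cast; rfl
  have hv := exact_inputVal (C * r) r m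
  refine ⟨C * r, r, hr0, goal_reached hk hp (by exact_mod_cast hr0) hv h ?_ ?_,
    ChainPTA.goal_reached hv ?_ ?_⟩
  · push_cast
    rw [hC']
  · refine le_of_le_of_eq ?_ hq'
    push_cast
    gcongr ?_ * _
    rw [hC']
    calc (n : ℝ≥0) + 2 ≤ m + (n + 2) := le_add_self
      _ = _ := by ring
  · push_cast
    gcongr
    rw [hC', add_assoc]
    exact le_self_add
  · refine le_of_le_of_eq ?_ hq'
    push_cast
    gcongr ?_ * _
    rw [hC']
    exact le_self_add.trans le_self_add

end CounterPTA

/-! ### The undecidable synthesis set and the theorem. -/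

namespace CounterPTA

theorem exists_regBound_le (p : Prog) : ∃ k, 0 < k ∧ ∀ e ∈ p.graph [], regBound e.2.1 ≤ k :=
  ⟨((p.graph []).map fun e => regBound e.2.1).sum + 1, Nat.succ_pos _, fun _ he =>
    (List.le_sum_of_mem (List.mem_map_of_mem (f := fun e => regBound e.2.1) he)).trans (Nat.le_succ _)⟩

/-- An L/U-PTA that is reached in minimal time by an input valuation only if the input belongs to
an undecidable set, and by some such valuation for every input in the set. -/
theorem exists_undecidable_synth : ∃ (k : ℕ) (A : PTA k 6) (T : List ℕ), A.IsLUInstance T ∧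
    (∀ v ∈ A.minTimeSynth T, v 0 ≤ v 1 ∧ v 2 ≤ v 3 ∧ v 0 ≤ v 3 ∧ v 4 ≤ v 5) ∧
    (∀ s r m, inputVal s r m ∈ A.minTimeSynth T → 0 < r ∧ ∃ t, haltTest m t = 0) ∧
    ∀ m, (∃ t, haltTest m t = 0) → ∃ s r, inputVal s r m ∈ A.minTimeSynth T ∧
      ((ChainPTA.aut m).reachDurations (inputVal s r m) (ChainPTA.goal m)).Nonempty := by
  obtain ⟨p, hp⟩ := Prog.exists_search primrec_haltTest
  obtain ⟨k, hk, hkp⟩ := exists_regBound_le p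
  have hpath : ∀ m, (∃ c n, Prog.Path (p.graph []) [p] (start m) [] c n) ↔
      ∃ t, haltTest m t = 0 := fun m => (Prog.exists_path_iff p _).trans (hp m)
  -- The input `1` is accepted, which provides a valuation with reachable target.
  obtain ⟨c, n, hc⟩ := (hpath _).2 (exists_haltTest_one 0)
  obtain ⟨s, r, -, hsr, -⟩ := exists_inputVal hk hkp hc
  have hsynth := PTA.minTimeSynth_eq
    (fun v t ht => eq_one_of_mem_reachDurations hk ht) hsr
  refine ⟨k + 2, aut k p, goal, isLUInstance k p, ?_, ?_, ?_⟩
  · rw [hsynth]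
    exact fun v hv => bounds_of_goal_reached hk hv
  · rw [hsynth]
    intro s r m hv
    obtain ⟨h1, h2⟩ := exists_path_of_goal_reached hk hkp (exact_inputVal s r m) hv
    exact ⟨by exact_mod_cast h1, (hpath m).1 h2⟩
  · rw [hsynth]
    intro m hm
    obtain ⟨c, n, hc⟩ := (hpath m).2 hm
    obtain ⟨s, r, -, h1, h2⟩ := exists_inputVal hk hkp hc
    exact ⟨s, r, h1, h2⟩

end CounterPTA

theorem ChainPTA.minTimeSynth_eq (m : ℕ) : (ChainPTA.aut m).minTimeSynth (ChainPTA.goal m) =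
    {v | ((ChainPTA.aut m).reachDurations v (ChainPTA.goal m)).Nonempty} := by
  -- With `s = m * r`, both conditions of `ChainPTA.goal_reached` hold with equality.
  set r : ℚ≥0 := ((m + 1) * (m + 1))⁻¹ with hr
  have hq : ((m : ℚ≥0) + 1) * (m * r + r) = 1 := by
    rw [hr]
    field_simp
  refine PTA.minTimeSynth_eq (fun v t ht => ChainPTA.eq_one_of_mem_reachDurations ht)
    (ChainPTA.goal_reached (CounterPTA.exact_inputVal (m * r) r m) (by push_cast; rfl) ?_)
  exact_mod_cast hq.le

-- The chain bounds each pair of parameters in one direction and `hb` in the other, so the pairs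
-- coincide. The remaining bound `v 0 ≤ v 3` gives `s ≤ q`, whence `r` exists in `ℚ≥0`.
open CounterPTA in
theorem ChainPTA.eq_inputVal_of_mem {m : ℕ} {v : ParamVal 6}
    (hv : v ∈ (ChainPTA.aut m).minTimeSynth (ChainPTA.goal m))
    (hb : v 0 ≤ v 1 ∧ v 2 ≤ v 3 ∧ v 0 ≤ v 3 ∧ v 4 ≤ v 5) : ∃ s r, v = inputVal s r m := by
  rw [ChainPTA.minTimeSynth_eq] at hv
  obtain ⟨h1, h2, h3⟩ := ChainPTA.bounds_of_goal_reached hv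
  have e1 : v 1 = v 0 := h1.antisymm hb.1
  have e2 : v 3 = v 2 := h2.antisymm hb.2.1
  have e3 : v 5 = v 4 := h3.antisymm hb.2.2.2
  obtain ⟨r, hr⟩ := exists_add_of_le (hb.2.2.1.trans e2.le)
  refine ⟨v 0, r, eq_inputVal e1 e2 e3 hr ?_⟩
  have := ChainPTA.eq_of_goal_reached (s := (v 0 : ℚ≥0)) (r := (r : ℚ≥0)) (i := (v 4 : ℚ≥0))
    ⟨rfl, by rw [e1]⟩ ⟨by rw [hr]; push_cast; rfl, by rw [e2, hr]; push_cast; rfl⟩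
    ⟨rfl, by rw [e3]⟩ hv
  exact_mod_cast this

/-- A convex combination of the valuations for two inputs, with an input in between. -/
theorem CounterPTA.exists_convexCombination (s r s' r' : ℚ≥0) (hr : 0 < r) (m d : ℕ) :
    ∃ a b s₁ r₁ : ℚ≥0, a + b = 1 ∧
      (fun j => a * inputVal s r m j + b * inputVal s' r' (m + 1 + d) j) =
        inputVal s₁ r₁ (m + 1) := by
  have hpos : 0 < r' * d + r := by positivity
  -- The condition `a (m + 1) r + b (m + 2 + d) r' = (m + 2) (a r + b r')` amounts to `a r = b d
  -- r'`, so the weights are proportional to `r' * d` and `r`.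
  refine ⟨r' * d / (r' * d + r), r / (r' * d + r), _, _, ?_, eq_inputVal ?_ ?_ ?_
    (r := r' * d / (r' * d + r) * r + r / (r' * d + r) * r') ?_ ?_⟩
  · rw [← add_div, div_self hpos.ne']
  · rfl
  · rfl
  · rfl
  · simp [inputVal]
    ring
  · simp [inputVal]
    field_simp
    ring

open CounterPTA in
theorem mainTheorem5 :
    (∀ F : Formalism, F.DecidesInterEmptiness → ¬ F.SolvesMinTimeSynthLU) ∧
    (∃ (k n : ℕ) (A : PTA k n) (T : List ℕ), A.IsLUInstance T ∧
      (∀ F : Formalism, F.DecidesInterEmptiness → F.ExpressesPolyhedra →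
        ¬ ∃ c : F.Code n, F.denote c = A.minTimeSynth T) ∧
      ¬ ∃ Ps : List (Polyhedron n), A.minTimeSynth T = ⋃ P ∈ Ps, Polyhedron.toSet P) := by
  obtain ⟨k, A, T, hLU, hbounds, hsound, hcomplete⟩ := exists_undecidable_synth
  refine ⟨fun F hF hS => ?_, k, 6, A, T, hLU, fun F hF hP => ?_, ?_⟩
  · obtain ⟨f, -, hf⟩ := hS k 6
    obtain ⟨g, hg, hg'⟩ := hS 3 6
    have hc : Computable fun m => (f (A, T), g (ChainPTA.aut m, ChainPTA.goal m)) :=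
      (Computable.const _).pair
        (hg.comp (ChainPTA.primrec_aut.pair ChainPTA.primrec_goal).to_comp)
    refine not_computablePred_of_haltTest hc (fun m => ?_) (hF 6)
    rw [hf A T hLU, hg' _ _ (ChainPTA.isLUInstance m), ← not_iff_not, not_not,
      ← Ne, ← Set.nonempty_iff_ne_empty]
    constructor
    · rintro ⟨v, h1, h2⟩
      obtain ⟨s, r, rfl⟩ := ChainPTA.eq_inputVal_of_mem h2 (hbounds v h1)
      exact (hsound s r m h1).2
    · intro h
      obtain ⟨s, r, h1, h2⟩ := hcomplete m h
      exact ⟨_, h1, by rw [ChainPTA.minTimeSynth_eq]; exact h2⟩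
  · rintro ⟨c, hc⟩
    obtain ⟨g, hg, hg'⟩ := hP 6
    have hcomp : Computable fun m => (c, g (inputPolyhedron m)) :=
      (Computable.const _).pair (hg.comp primrec_inputPolyhedron.to_comp)
    refine not_computablePred_of_haltTest hcomp (fun m => ?_) (hF 6)
    rw [hc, hg', ← not_iff_not, not_not, ← Ne, ← Set.nonempty_iff_ne_empty]
    constructor
    · rintro ⟨v, h1, h2⟩
      obtain ⟨s, r, rfl⟩ := mem_inputPolyhedron.1 h2
      exact (hsound s r m h1).2
    · intro h
      obtain ⟨s, r, h1, -⟩ := hcomplete m h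
      exact ⟨_, h1, mem_inputPolyhedron.2 ⟨s, r, rfl⟩⟩
  · rintro ⟨Ps, hPs⟩
    have hmem : ∀ v, v ∈ A.minTimeSynth T ↔ ∃ P ∈ Ps, v ∈ P.toSet := fun v => by
      rw [hPs]; simp
    -- Infinitely many accepted inputs `3 a + 1` are spread over finitely many polyhedra.
    have h1 : ∀ a : ℕ, ∃ P : {P // P ∈ Ps}, ∃ s r,
        inputVal s r (3 * a + 1) ∈ P.1.toSet := fun a => by
      obtain ⟨s, r, h, -⟩ := hcomplete _ (exists_haltTest_one a)
      obtain ⟨P, hP, h⟩ := (hmem _).1 h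
      exact ⟨⟨P, hP⟩, s, r, h⟩
    choose P s r h1 using h1
    have : Finite {P // P ∈ Ps} := List.finite_toSet Ps
    obtain ⟨a, b, hne, hab⟩ := Finite.exists_ne_map_eq_of_infinite P
    wlog hlt : a < b generalizing a b
    · exact this b a hne.symm hab.symm (by omega)
    obtain ⟨d, rfl⟩ := Nat.exists_eq_add_of_lt hlt
    have h2 := h1 (a + d + 1)
    -- The larger input is brought to the form `m + 1 + d` with `m = 3 a + 1`; the combination then
    -- encodes `m + 1 = 3 a + 2`, which is never accepted.
    rw [← hab, show 3 * (a + d + 1) + 1 = 3 * a + 1 + 1 + (3 * d + 2) by ring] at h2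
    have hr := (hsound _ _ _ ((hmem _).2 ⟨_, (P a).2, h1 a⟩)).1
    obtain ⟨x, y, s₁, r₁, hxy, h⟩ := exists_convexCombination (s a) (r a) (s (a + d + 1))
      (r (a + d + 1)) hr (3 * a + 1) (3 * d + 2)
    have h3 := Polyhedron.convexCombination_mem (h1 a) h2 hxy
    rw [h] at h3
    exact not_exists_haltTest_two a (hsound _ _ _ ((hmem _).2 ⟨_, (P a).2, h3⟩)).2
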